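/- Let $X$ be the formal spectrum of an arbitrary $C^\infty$-ring $A=C^\infty(X)$, i.e. $X$ is the object corresponding to $A$ in the opposite of the category of $C^\infty$-rings. For an ideal $I$ of a $C^\infty$-ring $B$ let $\sqrt[\mathrm{nil}]{I}$ be its nilradical and let $\sqrt[\infty]{I}=\{f\in B : (B/I)\{f^{-1}\}\cong 0\}$ be its $\infty$-radical, where $(B/I)\{f^{-1}\}$ is the $C^\infty$-ring obtained from $B/I$ by universally inverting $f$. Fix $\rho\in\{\mathrm{nil},\infty\}$, let $\mathrm{red}_\rho(B)=B/\sqrt[\rho]{0}$, and call $X$ $\mathrm{red}_\rho$-injective if for every $C^\infty$-ring $B$ every morphism $A\to \mathrm{red}_\rho(B)$ lifts along $B\to\mathrm{red}_\rho(B)$. Work with presheaves on the site of spectra $Z$ of finitely generated $C^\infty$-rings with the Zariski topology: its covering families are the finite families $\{Z_i\to Z\}$ such that each $C^\infty(Z)\to C^\infty(Z_i)$ is the universal morphism inverting an element $a_i$, and the $a_i$ generate the unit ideal. The $\rho$-de Rham space of $X$ is the presheaf of sets $X_{\rho\text{-}\mathrm{dR}}(Z)=\mathrm{Hom}(A,\mathrm{red}_\rho(C^\infty(Z)))$.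 For $m\geq 1$ let $\Delta_m$ be the kernel of the codiagonal $C^\infty(X^m)=A\otimes_\infty\cdots\otimes_\infty A\to A$, and let $N^\rho_m(Z)\subseteq\mathrm{Hom}(A,C^\infty(Z))^m=\mathrm{Hom}(C^\infty(X^m),C^\infty(Z))$ consist of the morphisms that vanish on some ideal $I$ with $\sqrt[\rho]{I}=\sqrt[\rho]{\Delta_m}$ (the points of the pro-nilpotent neighbourhood of the main diagonal in $X^m$ if $\rho=\mathrm{nil}$, and of its $\infty$-nilpotent, or germ, neighbourhood if $\rho=\infty$). Suppose that $X$ is $\mathrm{red}_\rho$-injective. Then $N^\rho_2$ is a subgroupoid of the pair groupoid of $X$ (the formal de Rham groupoid if $\rho=\mathrm{nil}$, the germ de Rham groupoid if $\rho=\infty$), and the presheaves $N^\rho_{k+1}$, $k\geq 0$, with the structure maps given by the projections and diagonals of the powers of $X$, form its nerve, which is a simplicial presheaf. The canonical morphism from this simplicial presheaf to $X_{\rho\text{-}\mathrm{dR}}$, regarded as a constant simplicial presheaf, is both 1. a global weak equivalence, i.e. for every $Z$ the map of simplicial sets of sections over $Z$ is a weak equivalence, and 2. a local weak equivalence, i.e.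 it induces isomorphisms of the Zariski sheaves of connected components and, for every $Z$ and every vertex over $Z$, of the Zariski sheaves of homotopy groups on the site of objects over $Z$. This holds for both $\rho=\mathrm{nil}$ and $\rho=\infty$. -/

import Mathlib

open scoped ContDiff Topology
namespace CInf

/-- Integrals of smooth functions depend smoothly on parameters. -/
theorem contDiff_integral_param {E : Type} [NormedAddCommGroup E] [NormedSpace ℝ E]
    [FiniteDimensional ℝ E] (n : ℕ) :
    ∀ {G : Type} [NormedAddCommGroup G] [NormedSpace ℝ G] [CompleteSpace G] (F : E × ℝ → G),
      ContDiff ℝ ∞ F → ContDiff ℝ n (fun x : E => ∫ t in (0:ℝ)..1, F (x, t)) := by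
  have key : ∀ {G : Type} [NormedAddCommGroup G] [NormedSpace ℝ G] (F : E × ℝ → G),
      ContDiff ℝ ∞ F → ∀ x₀ : E, HasFDerivAt (fun x : E => ∫ t in (0:ℝ)..1, F (x, t))
        (∫ t in (0:ℝ)..1, (fderiv ℝ F (x₀, t)).comp (ContinuousLinearMap.inl ℝ E ℝ)) x₀ := by
    intro G _ _ F hF x₀
    have hF' : Continuous (fun p : E × ℝ =>
        (fderiv ℝ F p).comp (ContinuousLinearMap.inl ℝ E ℝ)) :=
      (hF.continuous_fderiv (by simp)).clm_comp continuous_const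
    have hK : IsCompact (Metric.closedBall x₀ 1 ×ˢ Set.Icc (0:ℝ) 1) :=
      (isCompact_closedBall x₀ 1).prod isCompact_Icc
    obtain ⟨C, hC⟩ := hK.exists_bound_of_continuousOn hF'.continuousOn
    refine intervalIntegral.hasFDerivAt_integral_of_dominated_of_fderiv_le
      (F := fun x t => F (x, t))
      (F' := fun x t => (fderiv ℝ F (x, t)).comp (ContinuousLinearMap.inl ℝ E ℝ))
      (bound := fun _ => C) (s := Metric.closedBall x₀ 1)
      (Metric.closedBall_mem_nhds x₀ one_pos) ?_ ?_ ?_ ?_ ?_ ?_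
    · exact Filter.Eventually.of_forall fun x =>
        (hF.continuous.comp (by fun_prop)).aestronglyMeasurable
    · exact (hF.continuous.comp (by fun_prop : Continuous fun t : ℝ => (x₀, t))).intervalIntegrable _ _
    · exact (hF'.comp (by fun_prop : Continuous fun t : ℝ => (x₀, t))).aestronglyMeasurable
    · refine Filter.Eventually.of_forall fun t ht x hx => hC (x, t) ⟨hx, ?_⟩
      rw [Set.uIoc_of_le zero_le_one] at ht
      exact ⟨ht.1.le, ht.2⟩
    · exact intervalIntegrable_const
    · refine Filter.Eventually.of_forall fun t _ x _ => ?_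
      have h1 : HasFDerivAt F (fderiv ℝ F (x, t)) (x, t) :=
        (hF.differentiable (by simp) _).hasFDerivAt
      exact h1.comp x (hasFDerivAt_prodMk_left x t)
  induction n with
  | zero =>
    intro G _ _ _ F hF
    rw [Nat.cast_zero, contDiff_zero]
    exact continuous_iff_continuousAt.2 fun x => (key F hF x).continuousAt
  | succ n ih =>
    intro G _ _ _ F hF
    rw [Nat.cast_succ, contDiff_succ_iff_fderiv]
    refine ⟨fun x => (key F hF x).differentiableAt, by simp, ?_⟩
    have : fderiv ℝ (fun x : E => ∫ t in (0:ℝ)..1, F (x, t)) = fun x =>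
        ∫ t in (0:ℝ)..1, (fun p : E × ℝ =>
          (fderiv ℝ F p).comp (ContinuousLinearMap.inl ℝ E ℝ)) (x, t) :=
      funext fun x => (key F hF x).fderiv
    rw [this]
    exact ih _ ((hF.fderiv_right (m := ∞) (by simp)).clm_comp contDiff_const)

/-- Hadamard's lemma. -/
theorem hadamard {n : ℕ} (f : (Fin n → ℝ) → ℝ) (hf : ContDiff ℝ ∞ f) :
    ∃ g : Fin n → (Fin n → ℝ) × (Fin n → ℝ) → ℝ, (∀ i, ContDiff ℝ ∞ (g i)) ∧
      ∀ x y, f x - f y = ∑ i, (x i - y i) * g i (x, y) := by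
  refine ⟨fun i p => ∫ t in (0:ℝ)..1, fderiv ℝ f (p.2 + t • (p.1 - p.2)) (Pi.single i 1),
    fun i => ?_, fun x y => ?_⟩
  · rw [contDiff_infty]
    intro m
    refine contDiff_integral_param m (fun q : ((Fin n → ℝ) × (Fin n → ℝ)) × ℝ =>
      fderiv ℝ f (q.1.2 + q.2 • (q.1.1 - q.1.2)) (Pi.single i 1)) ?_
    exact ((hf.fderiv_right (m := ∞) (by simp)).comp (by fun_prop)).clm_apply contDiff_const
  · have hd : ∀ t : ℝ, HasDerivAt (fun t : ℝ => f (y + t • (x - y)))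
        (fderiv ℝ f (y + t • (x - y)) (x - y)) t := by
      intro t
      have h1 : HasDerivAt (fun t : ℝ => y + t • (x - y)) (x - y) t := by
        simpa using ((hasDerivAt_id t).smul_const (x - y)).const_add y
      exact ((hf.differentiable (by simp) _).hasFDerivAt).comp_hasDerivAt t h1
    have hc : Continuous fun t : ℝ => fderiv ℝ f (y + t • (x - y)) :=
      (hf.continuous_fderiv (by simp)).comp (by fun_prop)
    have h2 := intervalIntegral.integral_eq_sub_of_hasDerivAt (a := 0) (b := 1)
      (fun t _ => hd t) ((hc.clm_apply continuous_const).intervalIntegrable _ _)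
    simp only [one_smul, zero_smul, add_zero, add_sub_cancel] at h2
    rw [← h2]
    have h3 : ∀ t : ℝ, fderiv ℝ f (y + t • (x - y)) (x - y) =
        ∑ i, (x i - y i) * fderiv ℝ f (y + t • (x - y)) (Pi.single i 1) := by
      intro t
      generalize fderiv ℝ f (y + t • (x - y)) = L
      conv_lhs => rw [← Finset.univ_sum_single (x - y)]
      rw [map_sum]
      refine Finset.sum_congr rfl fun i _ => ?_
      have : (Pi.single i ((x - y) i) : Fin n → ℝ) = (x i - y i) • Pi.single i (1 : ℝ) := by
        rw [← Pi.single_smul, smul_eq_mul, mul_one, Pi.sub_apply]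
      rw [this, map_smul, smul_eq_mul]
    simp_rw [h3]
    rw [intervalIntegral.integral_finsetSum]
    · simp
    · intro i _
      exact (continuous_const.mul (hc.clm_apply continuous_const)).intervalIntegrable _ _
end CInf

universe u

namespace CInf

/-- The smooth functions on `ℝⁿ`, as a subring of all real functions on `ℝⁿ`. -/
def smoothSubring (n : ℕ) : Subring ((Fin n → ℝ) → ℝ) where
  carrier := {f | ContDiff ℝ ∞ f}
  mul_mem' {f g} hf hg := by
    rw [Set.mem_ofPred_eq] at *; exact hf.mul hg
  one_mem' := by rw [Set.mem_ofPred_eq]; exact contDiff_const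
  add_mem' {f g} hf hg := by
    rw [Set.mem_ofPred_eq] at *; exact hf.add hg
  zero_mem' := by rw [Set.mem_ofPred_eq]; exact contDiff_const
  neg_mem' {f} hf := by
    rw [Set.mem_ofPred_eq] at *; exact hf.neg

theorem mem_smoothSubring {n : ℕ} {f : (Fin n → ℝ) → ℝ} :
    f ∈ smoothSubring n ↔ ContDiff ℝ ∞ f := Iff.rfl

/-- The ring `C^∞(ℝⁿ)`. -/
abbrev SmoothFn (n : ℕ) : Type := smoothSubring n

namespace SmoothFn

/-- The `i`-th coordinate function. -/
def proj {n : ℕ} (i : Fin n) : SmoothFn n := ⟨fun x => x i, mem_smoothSubring.2 (contDiff_apply ℝ ℝ i)⟩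

/-- Composition `f ∘ (g₁, …, g_m)`. -/
def comp {m n : ℕ} (f : SmoothFn m) (g : Fin m → SmoothFn n) : SmoothFn n :=
  ⟨fun x => f.1 fun i => (g i).1 x, mem_smoothSubring.2 ((mem_smoothSubring.1 f.2).comp
    (contDiff_pi.2 fun i => mem_smoothSubring.1 (g i).2))⟩

/-- The map `ℝ² → ℝ`, `(x, y) ↦ x + y`. -/
def addFn : SmoothFn 2 := proj 0 + proj 1

/-- The map `ℝ² → ℝ`, `(x, y) ↦ x * y`. -/
def mulFn : SmoothFn 2 := proj 0 * proj 1

theorem add_eq_comp {n : ℕ} (f g : SmoothFn n) : f + g = addFn.comp ![f, g] := by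
  rfl

theorem mul_eq_comp {n : ℕ} (f g : SmoothFn n) : f * g = mulFn.comp ![f, g] := rfl

end SmoothFn

/-- A `C^∞`-ring: a set on which every smooth map `ℝⁿ → ℝ` acts as an `n`-ary operation, compatibly
with coordinate projections and composition (equivalently, a product preserving functor to sets
from the category of the spaces `ℝⁿ` and smooth maps). The underlying commutative ring is recorded
as part of the data; it is the one determined by the operations. -/
class CInftyRing (A : Type u) extends CommRing A where
  op : ∀ {n : ℕ}, SmoothFn n → (Fin n → A) → A
  op_proj : ∀ {n : ℕ} (i : Fin n) (a : Fin n → A), op (SmoothFn.proj i) a = a i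
  op_comp : ∀ {m n : ℕ} (f : SmoothFn m) (g : Fin m → SmoothFn n) (a : Fin n → A),
    op (f.comp g) a = op f fun i => op (g i) a
  op_addFn : ∀ a : Fin 2 → A, op SmoothFn.addFn a = a 0 + a 1
  op_mulFn : ∀ a : Fin 2 → A, op SmoothFn.mulFn a = a 0 * a 1

open CInftyRing (op)

section Basic

variable {A : Type u} [CInftyRing A] {n : ℕ}

theorem op_add (f g : SmoothFn n) (a : Fin n → A) : op (f + g) a = op f a + op g a := by
  rw [SmoothFn.add_eq_comp, CInftyRing.op_comp, CInftyRing.op_addFn]; rfl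

theorem op_mul (f g : SmoothFn n) (a : Fin n → A) : op (f * g) a = op f a * op g a := by
  rw [SmoothFn.mul_eq_comp, CInftyRing.op_comp, CInftyRing.op_mulFn]; rfl

theorem op_zero (a : Fin n → A) : op (0 : SmoothFn n) a = 0 := by
  have := op_add (0 : SmoothFn n) 0 a
  simpa using this

/-- Constants act by constants: `1` acts by `1`. -/
theorem op_one (a : Fin n → A) : op (1 : SmoothFn n) a = 1 := by
  have h : ∀ b : A, op (1 : SmoothFn n) a * b = b := by
    intro b
    have h1 : op (1 : SmoothFn n) a = op (1 : SmoothFn (n + 1)) (Fin.snoc a b : Fin (n + 1) → A) := by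
      have : (1 : SmoothFn (n + 1)) =
          (1 : SmoothFn n).comp fun i => SmoothFn.proj (Fin.castSucc i) := rfl
      rw [this, CInftyRing.op_comp]
      simp [CInftyRing.op_proj]
    have h2 : b = op (SmoothFn.proj (Fin.last n)) (Fin.snoc a b : Fin (n + 1) → A) := by
      simp [CInftyRing.op_proj]
    calc op (1 : SmoothFn n) a * b
        = op (1 : SmoothFn (n + 1)) (Fin.snoc a b : Fin (n + 1) → A) *
          op (SmoothFn.proj (Fin.last n)) (Fin.snoc a b : Fin (n + 1) → A) := by rw [h1, ← h2]
      _ = b := by rw [← op_mul, one_mul, ← h2]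
  simpa using h 1

/-- Evaluation at a tuple `a` of elements, as a ring homomorphism `C^∞(ℝⁿ) → A`. -/
def opHom (a : Fin n → A) : SmoothFn n →+* A where
  toFun f := op f a
  map_one' := op_one a
  map_mul' f g := op_mul f g a
  map_zero' := op_zero a
  map_add' f g := op_add f g a

/-- Ideals are congruences for all smooth operations. -/
theorem op_sub_op_mem (I : Ideal A) (f : SmoothFn n) (a b : Fin n → A)
    (h : ∀ i, a i - b i ∈ I) : op f a - op f b ∈ I := by
  obtain ⟨g, hg, hfg⟩ := hadamard f.1 (mem_smoothSubring.1 f.2)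
  let l : Fin n → Fin (n + n) := Fin.castAdd n
  let r : Fin n → Fin (n + n) := Fin.natAdd n
  let G : Fin n → SmoothFn (n + n) := fun i =>
    ⟨fun z => g i (fun j => z (l j), fun j => z (r j)), 
      mem_smoothSubring.2 ((hg i).comp (by fun_prop))⟩
  let c : Fin (n + n) → A := Fin.append a b
  have hl : op f a = opHom c (f.comp fun i => SmoothFn.proj (l i)) := by
    change _ = op _ c
    rw [CInftyRing.op_comp]
    simp [CInftyRing.op_proj, c, l]
  have hr : op f b = opHom c (f.comp fun i => SmoothFn.proj (r i)) := by
    change _ = op _ c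
    rw [CInftyRing.op_comp]
    simp only [CInftyRing.op_proj, c, r, Fin.append_right]
  have key : (f.comp fun i => SmoothFn.proj (l i)) - (f.comp fun i => SmoothFn.proj (r i)) =
      ∑ i, (SmoothFn.proj (l i) - SmoothFn.proj (r i)) * G i := by
    apply Subtype.ext
    funext z
    rw [AddSubgroupClass.coe_sub, Pi.sub_apply, AddSubmonoidClass.coe_finsetSum,
      Finset.sum_apply]
    exact hfg (fun i => z (l i)) (fun i => z (r i))
  rw [hl, hr, ← map_sub, key, map_sum]
  refine I.sum_mem fun i _ => ?_
  rw [map_mul, map_sub]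
  refine I.mul_mem_right _ ?_
  have e1 : opHom c (SmoothFn.proj (l i)) = a i := by
    change op _ c = _
    simp [CInftyRing.op_proj, c, l]
  have e2 : opHom c (SmoothFn.proj (r i)) = b i := by
    change op _ c = _
    simp only [CInftyRing.op_proj, c, r, Fin.append_right]
  rw [e1, e2]
  exact h i

end Basic

/-- Homomorphisms of `C^∞`-rings: maps commuting with all smooth operations. -/
structure Hom (A B : Type u) [CInftyRing A] [CInftyRing B] extends A →+* B where
  map_op' : ∀ {n : ℕ} (f : SmoothFn n) (a : Fin n → A), toFun (op f a) = op f fun i => toFun (a i)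

infixr:25 " →∞ " => Hom

namespace Hom

variable {A B C : Type u} [CInftyRing A] [CInftyRing B] [CInftyRing C]

instance : FunLike (A →∞ B) A B where
  coe φ := φ.toFun
  coe_injective φ ψ h := by
    cases φ; cases ψ; congr; exact RingHom.ext (congrFun h)

instance : RingHomClass (A →∞ B) A B where
  map_mul φ := φ.map_mul'
  map_one φ := φ.map_one'
  map_add φ := φ.map_add'
  map_zero φ := φ.map_zero'

theorem map_op (φ : A →∞ B) {n : ℕ} (f : SmoothFn n) (a : Fin n → A) :
    φ (op f a) = op f fun i => φ (a i) := φ.map_op' f a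

@[ext] theorem ext {φ ψ : A →∞ B} (h : ∀ a, φ a = ψ a) : φ = ψ := DFunLike.ext _ _ h

/-- A map commuting with all smooth operations is automatically a ring homomorphism. -/
def ofMapOp (φ : A → B)
    (h : ∀ {n : ℕ} (f : SmoothFn n) (a : Fin n → A), φ (op f a) = op f fun i => φ (a i)) :
    A →∞ B where
  toFun := φ
  map_one' := by rw [← op_one (n := 0) Fin.elim0, h, op_one]
  map_zero' := by rw [← op_zero (n := 0) Fin.elim0, h, op_zero]
  map_add' x y := by
    have := h SmoothFn.addFn ![x, y]
    simpa [CInftyRing.op_addFn] using this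
  map_mul' x y := by
    have := h SmoothFn.mulFn ![x, y]
    simpa [CInftyRing.op_mulFn] using this
  map_op' := h

/-- The identity. -/
def id (A : Type u) [CInftyRing A] : A →∞ A := ofMapOp (fun a => a) fun _ _ => rfl

/-- Composition `ψ ∘ φ`. -/
def comp (ψ : B →∞ C) (φ : A →∞ B) : A →∞ C :=
  ofMapOp (fun a => ψ (φ a)) fun f a => by rw [φ.map_op, ψ.map_op]

@[simp] theorem id_apply (a : A) : Hom.id A a = a := rfl

@[simp] theorem comp_apply (ψ : B →∞ C) (φ : A →∞ B) (a : A) : ψ.comp φ a = ψ (φ a) := rfl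

end Hom

section Quotient

variable {A : Type u} [CInftyRing A] (I : Ideal A)

theorem mk_op_eq {n : ℕ} (f : SmoothFn n) (a b : Fin n → A)
    (h : ∀ i, Ideal.Quotient.mk I (a i) = Ideal.Quotient.mk I (b i)) :
    Ideal.Quotient.mk I (op f a) = Ideal.Quotient.mk I (op f b) :=
  Ideal.Quotient.eq.2 (op_sub_op_mem I f a b fun i => Ideal.Quotient.eq.1 (h i))

/-- The quotient of a `C^∞`-ring by an ideal. -/
noncomputable instance : CInftyRing (A ⧸ I) :=
  { (inferInstance : CommRing (A ⧸ I)) with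
    op := fun f q => Ideal.Quotient.mk I (op f fun i => Quotient.out (q i))
    op_proj := fun i q => by
      rw [CInftyRing.op_proj]; exact Quotient.out_eq _
    op_comp := fun f g q => by
      rw [CInftyRing.op_comp]
      refine mk_op_eq I f _ _ fun i => ?_
      exact (Quotient.out_eq _).symm
    op_addFn := fun q => by
      rw [CInftyRing.op_addFn, map_add]
      exact congrArg₂ (· + ·) (Quotient.out_eq _) (Quotient.out_eq _)
    op_mulFn := fun q => by
      rw [CInftyRing.op_mulFn, map_mul]
      exact congrArg₂ (· * ·) (Quotient.out_eq _) (Quotient.out_eq _) }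

/-- The projection `A → A ⧸ I`. -/
noncomputable def quotMk : A →∞ (A ⧸ I) :=
  Hom.ofMapOp (Ideal.Quotient.mk I) fun f a =>
    mk_op_eq I f _ _ fun _ => (Quotient.out_eq _).symm

variable {I}

@[simp] theorem quotMk_apply (a : A) : quotMk I a = Ideal.Quotient.mk I a := rfl

/-- The homomorphism `A ⧸ I → B` induced by a homomorphism that vanishes on `I`. -/
noncomputable def quotLift {B : Type u} [CInftyRing B] (φ : A →∞ B) (h : ∀ a ∈ I, φ a = 0) :
    (A ⧸ I) →∞ B :=
  Hom.ofMapOp (Ideal.Quotient.lift I φ.toRingHom h) fun f q => by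
    have hq : ∀ i, Ideal.Quotient.lift I φ.toRingHom h (q i) = φ (Quotient.out (q i)) := fun i => by
      conv_lhs => rw [← Quotient.out_eq (q i)]
      rfl
    simp only [hq, ← φ.map_op]
    rfl

@[simp] theorem quotLift_mk {B : Type u} [CInftyRing B] (φ : A →∞ B) (h : ∀ b ∈ I, φ b = 0)
    (a : A) : quotLift φ h (Ideal.Quotient.mk I a) = φ a := rfl

end Quotient


/-- Operations that respect projections and composition determine a `C^∞`-ring: the ring structure
is given by the operations `x + y`, `x * y`, `-x`, `0`, `1`. -/
@[reducible] def CInftyRing.ofOp (A : Type u)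
    (o : ∀ {n : ℕ}, SmoothFn n → (Fin n → A) → A)
    (hp : ∀ {n : ℕ} (i : Fin n) (a : Fin n → A), o (SmoothFn.proj i) a = a i)
    (hc : ∀ {m n : ℕ} (f : SmoothFn m) (g : Fin m → SmoothFn n) (a : Fin n → A),
      o (f.comp g) a = o f fun i => o (g i) a) : CInftyRing A :=
  have ha : ∀ {n : ℕ} (f g : SmoothFn n) (a : Fin n → A),
      o SmoothFn.addFn ![o f a, o g a] = o (f + g) a := fun f g a => by
    rw [SmoothFn.add_eq_comp, hc]
    congr 1; funext i; fin_cases i <;> rfl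
  have hm : ∀ {n : ℕ} (f g : SmoothFn n) (a : Fin n → A),
      o SmoothFn.mulFn ![o f a, o g a] = o (f * g) a := fun f g a => by
    rw [SmoothFn.mul_eq_comp, hc]
    congr 1; funext i; fin_cases i <;> rfl
  have hk : ∀ {m n : ℕ} (f : SmoothFn m) (b : Fin m → A) (g : Fin m → SmoothFn n) (a : Fin n → A),
      (∀ i, b i = o (g i) a) → o f b = o (f.comp g) a := fun f b g a h => by
    rw [hc]; congr 1; funext i; exact h i
  have h0 : ∀ {n : ℕ} (a : Fin n → A), o (0 : SmoothFn 0) Fin.elim0 = o (0 : SmoothFn n) a :=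
    fun a => hk 0 _ Fin.elim0 a fun i => i.elim0
  have h1 : ∀ {n : ℕ} (a : Fin n → A), o (1 : SmoothFn 0) Fin.elim0 = o (1 : SmoothFn n) a :=
    fun a => hk 1 _ Fin.elim0 a fun i => i.elim0
  have hn : ∀ {n : ℕ} (f : SmoothFn n) (a : Fin n → A),
      o (-SmoothFn.proj 0 : SmoothFn 1) ![o f a] = o (-f) a := fun f a =>
    hk _ _ (fun _ => f) a fun i => by fin_cases i; rfl
  have hx3 : ∀ a b c : A, ∃ v : Fin 3 → A, a = o (SmoothFn.proj 0 : SmoothFn 3) v ∧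
      b = o (SmoothFn.proj 1 : SmoothFn 3) v ∧ c = o (SmoothFn.proj 2 : SmoothFn 3) v :=
    fun a b c => ⟨![a, b, c], (hp 0 ![a, b, c]).symm, (hp 1 ![a, b, c]).symm,
      (hp 2 ![a, b, c]).symm⟩
  letI : Add A := ⟨fun a b => o SmoothFn.addFn ![a, b]⟩
  letI : Mul A := ⟨fun a b => o SmoothFn.mulFn ![a, b]⟩
  letI : Neg A := ⟨fun a => o (-SmoothFn.proj 0 : SmoothFn 1) ![a]⟩
  letI : Zero A := ⟨o (0 : SmoothFn 0) Fin.elim0⟩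
  letI : One A := ⟨o (1 : SmoothFn 0) Fin.elim0⟩
  letI : CommRing A := CommRing.ofMinimalAxioms
    (fun a b c => by
      obtain ⟨v, rfl, rfl, rfl⟩ := hx3 a b c
      change o SmoothFn.addFn ![o SmoothFn.addFn ![_, _], _] =
        o SmoothFn.addFn ![_, o SmoothFn.addFn ![_, _]]
      rw [ha, ha, ha, ha, add_assoc])
    (fun a => by
      obtain ⟨v, rfl, -, -⟩ := hx3 a a a
      change o SmoothFn.addFn ![o (0 : SmoothFn 0) Fin.elim0, _] = _
      rw [h0 v, ha, zero_add])
    (fun a => by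
      obtain ⟨v, rfl, -, -⟩ := hx3 a a a
      change o SmoothFn.addFn ![o (-SmoothFn.proj 0 : SmoothFn 1) ![_], _] =
        o (0 : SmoothFn 0) Fin.elim0
      rw [h0 v, hn, ha, neg_add_cancel])
    (fun a b c => by
      obtain ⟨v, rfl, rfl, rfl⟩ := hx3 a b c
      change o SmoothFn.mulFn ![o SmoothFn.mulFn ![_, _], _] =
        o SmoothFn.mulFn ![_, o SmoothFn.mulFn ![_, _]]
      rw [hm, hm, hm, hm, mul_assoc])
    (fun a b => by
      obtain ⟨v, rfl, rfl, -⟩ := hx3 a b b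
      change o SmoothFn.mulFn ![_, _] = o SmoothFn.mulFn ![_, _]
      rw [hm, hm, mul_comm])
    (fun a => by
      obtain ⟨v, rfl, -, -⟩ := hx3 a a a
      change o SmoothFn.mulFn ![o (1 : SmoothFn 0) Fin.elim0, _] = _
      rw [h1 v, hm, one_mul])
    (fun a b c => by
      obtain ⟨v, rfl, rfl, rfl⟩ := hx3 a b c
      change o SmoothFn.mulFn ![_, o SmoothFn.addFn ![_, _]] =
        o SmoothFn.addFn ![o SmoothFn.mulFn ![_, _], o SmoothFn.mulFn ![_, _]]
      rw [ha, hm, hm, hm, ha, mul_add])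
  { op := o
    op_proj := hp
    op_comp := hc
    op_addFn := fun a => by
      change _ = o SmoothFn.addFn ![a 0, a 1]
      congr 1; funext i; fin_cases i <;> rfl
    op_mulFn := fun a => by
      change _ = o SmoothFn.mulFn ![a 0, a 1]
      congr 1; funext i; fin_cases i <;> rfl }

/-! Presentations by generators and relations. -/

/-- Formal expressions in the smooth operations and generators from `G`. -/
inductive Term (G : Type u) : Type u
  | gen : G → Term G
  | app : {n : ℕ} → SmoothFn n → (Fin n → Term G) → Term G

namespace Term

variable {G : Type u}

/-- The value of a formal expression in a `C^∞`-ring. -/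
def eval {B : Type u} [CInftyRing B] (v : G → B) : Term G → B
  | gen g => v g
  | app f t => op f fun i => eval v (t i)

/-- The smallest congruence that contains `r` and imposes the laws of `C^∞`-rings. -/
inductive Congr (r : Term G → Term G → Prop) : Term G → Term G → Prop
  | of {s t : Term G} : r s t → Congr r s t
  | refl (t : Term G) : Congr r t t
  | symm {s t : Term G} : Congr r s t → Congr r t s
  | trans {s t w : Term G} : Congr r s t → Congr r t w → Congr r s w
  | app {n : ℕ} (f : SmoothFn n) {s t : Fin n → Term G} :
      (∀ i, Congr r (s i) (t i)) → Congr r (.app f s) (.app f t)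
  | proj {n : ℕ} (i : Fin n) (t : Fin n → Term G) : Congr r (.app (SmoothFn.proj i) t) (t i)
  | comp {m n : ℕ} (f : SmoothFn m) (g : Fin m → SmoothFn n) (t : Fin n → Term G) :
      Congr r (.app (f.comp g) t) (.app f fun i => .app (g i) t)

/-- The congruence, as a setoid. -/
def setoid (r : Term G → Term G → Prop) : Setoid (Term G) :=
  ⟨Congr r, Congr.refl, Congr.symm, Congr.trans⟩

end Term

/-- The `C^∞`-ring with generators `G` and relations `r`. -/
def Presented {G : Type u} (r : Term G → Term G → Prop) : Type u := Quotient (Term.setoid r)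

namespace Presented

variable {G : Type u} (r : Term G → Term G → Prop)

/-- The class of a formal expression. -/
def mk (t : Term G) : Presented r := Quotient.mk (Term.setoid r) t

variable {r}

theorem mk_eq {s t : Term G} (h : Term.Congr r s t) : mk r s = mk r t := Quotient.sound h

theorem mk_app_out {n : ℕ} (f : SmoothFn n) (t : Fin n → Term G) :
    mk r (.app f fun i => Quotient.out (mk r (t i))) = mk r (.app f t) :=
  mk_eq (.app f fun i => Quotient.mk_out (s := Term.setoid r) (t i))

theorem mk_out (q : Presented r) : mk r (Quotient.out q) = q := Quotient.out_eq _

noncomputable instance : CInftyRing (Presented r) :=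
  CInftyRing.ofOp (Presented r) (fun f q => mk r (.app f fun i => Quotient.out (q i)))
    (fun i q => (mk_eq (.proj i _)).trans (mk_out _))
    (fun f g q => (mk_eq (.comp f g _)).trans (mk_app_out f _).symm)

theorem mk_app {n : ℕ} (f : SmoothFn n) (t : Fin n → Term G) :
    mk r (.app f t) = op f fun i => mk r (t i) := (mk_app_out f t).symm

/-- The homomorphism determined by the images of the generators. -/
noncomputable def lift {B : Type u} [CInftyRing B] (v : G → B)
    (h : ∀ s t, r s t → s.eval v = t.eval v) : Presented r →∞ B :=
  have hw : ∀ s t, Term.Congr r s t → s.eval v = t.eval v := fun s t hst => by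
    induction hst with
    | of hr => exact h _ _ hr
    | refl => rfl
    | symm _ ih => exact ih.symm
    | trans _ _ ih1 ih2 => exact ih1.trans ih2
    | app f _ ih => exact congrArg (op f) (funext ih)
    | proj i t => exact CInftyRing.op_proj i _
    | comp f g t => exact CInftyRing.op_comp f g _
  Hom.ofMapOp (Quotient.lift (Term.eval v) hw) fun {n} f q => by
    have hq : ∀ i, Quotient.lift (Term.eval v) hw (q i) = (Quotient.out (q i)).eval v := fun i => by
      conv_lhs => rw [← Quotient.out_eq (q i)]
      rfl
    simp only [hq]
    rfl

@[simp] theorem lift_gen {B : Type u} [CInftyRing B] (v : G → B)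
    (h : ∀ s t, r s t → s.eval v = t.eval v) (g : G) : lift v h (mk r (.gen g)) = v g := rfl

theorem hom_ext {B : Type u} [CInftyRing B] {φ ψ : Presented r →∞ B}
    (h : ∀ g, φ (mk r (.gen g)) = ψ (mk r (.gen g))) : φ = ψ := by
  ext q
  obtain ⟨t, rfl⟩ := Quotient.exists_rep q
  change φ (mk r t) = ψ (mk r t)
  induction t with
  | gen g => exact h g
  | app f t ih => rw [mk_app, Hom.map_op, Hom.map_op, funext ih]

end Presented

/-! Coproduct powers `A ⊗ ⋯ ⊗ A` in the category of `C^∞`-rings. -/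

/-- The defining relations of the `m`-fold coproduct power of `A`: on each of the `m` copies of `A`
the formal operations agree with those of `A`. -/
inductive CopowerRel (A : Type u) [CInftyRing A] (m : ℕ) :
    Term (Fin m × A) → Term (Fin m × A) → Prop
  | mk (i : Fin m) {n : ℕ} (f : SmoothFn n) (a : Fin n → A) :
      CopowerRel A m (.gen (i, op f a)) (.app f fun j => .gen (i, a j))

/-- The `m`-fold coproduct power of `A`, the ring `C^∞(X^m)` of the `m`-fold power of the space `X`
with `C^∞(X) = A`. -/
abbrev Copower (A : Type u) [CInftyRing A] (m : ℕ) : Type u := Presented (CopowerRel A m)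

namespace Copower

variable {A : Type u} [CInftyRing A] {m : ℕ}

/-- The inclusion of the `i`-th copy of `A`. -/
noncomputable def incl (i : Fin m) : A →∞ Copower A m :=
  Hom.ofMapOp (fun a => Presented.mk _ (.gen (i, a))) fun f a =>
    (Presented.mk_eq (.of (.mk i f a))).trans (Presented.mk_app f _)

/-- The homomorphism out of the coproduct power given by `m` homomorphisms out of `A`. -/
noncomputable def lift {B : Type u} [CInftyRing B] (x : Fin m → (A →∞ B)) : Copower A m →∞ B :=
  Presented.lift (fun p => x p.1 p.2) fun s t h => by
    cases h with
    | mk i f a => exact (x i).map_op f a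

@[simp] theorem lift_incl {B : Type u} [CInftyRing B] (x : Fin m → (A →∞ B)) (i : Fin m) (a : A) :
    lift x (incl i a) = x i a := rfl

theorem hom_ext {B : Type u} [CInftyRing B] {φ ψ : Copower A m →∞ B}
    (h : ∀ i a, φ (incl i a) = ψ (incl i a)) : φ = ψ :=
  Presented.hom_ext fun p => h p.1 p.2

/-- The ideal of the main diagonal `X → X^m`: the kernel of the codiagonal `A ⊗ ⋯ ⊗ A → A`. -/
noncomputable def diagIdeal (A : Type u) [CInftyRing A] (m : ℕ) : Ideal (Copower A m) :=
  RingHom.ker (lift fun _ : Fin m => Hom.id A)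

end Copower

/-! Localization. -/

/-- The defining relations of `A{a⁻¹}`: the operations on `A`, and `a * none = 1`. -/
inductive LocRel (A : Type u) [CInftyRing A] (a : A) : Term (Option A) → Term (Option A) → Prop
  | mk {n : ℕ} (f : SmoothFn n) (b : Fin n → A) :
      LocRel A a (.gen (some (op f b))) (.app f fun j => .gen (some (b j)))
  | inv : LocRel A a (.app SmoothFn.mulFn ![.gen (some a), .gen none]) (.gen (some 1))

/-- The `C^∞`-ring `A{a⁻¹}` obtained from `A` by universally inverting `a`. -/
abbrev Loc (A : Type u) [CInftyRing A] (a : A) : Type u := Presented (LocRel A a)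

/-- `φ : A → B` is the universal morphism inverting `a`. -/
def IsLoc {A B : Type u} [CInftyRing A] [CInftyRing B] (a : A) (φ : A →∞ B) : Prop :=
  IsUnit (φ a) ∧ ∀ (C : Type u) [CInftyRing C] (ψ : A →∞ C), IsUnit (ψ a) →
    ∃! χ : B →∞ C, χ.comp φ = ψ

namespace Loc

variable {A : Type u} [CInftyRing A] (a : A)

/-- The morphism `A → A{a⁻¹}`. -/
noncomputable def of : A →∞ Loc A a :=
  Hom.ofMapOp (fun b => Presented.mk _ (.gen (some b))) fun f b =>
    (Presented.mk_eq (.of (.mk f b))).trans (Presented.mk_app f _)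

theorem of_mul_inv : of a a * Presented.mk _ (.gen none) = 1 := by
  have h := Presented.mk_eq (.of (LocRel.inv (a := a)))
  rw [Presented.mk_app, CInftyRing.op_mulFn] at h
  exact h.trans (map_one (of a))

theorem isLoc : IsLoc a (of a) := by
  refine ⟨IsUnit.of_mul_eq_one _ (of_mul_inv a), fun C _ ψ hψ => ?_⟩
  obtain ⟨c, hc⟩ := hψ.exists_right_inv
  refine ⟨Presented.lift (fun o => o.elim c ψ) fun s t h => ?_, ?_, fun χ hχ => ?_⟩
  · cases h with
    | mk f b => exact ψ.map_op f b
    | inv =>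
      change op SmoothFn.mulFn _ = ψ 1
      rw [CInftyRing.op_mulFn, map_one]
      exact hc
  · ext b; rfl
  · refine Presented.hom_ext fun o => ?_
    have hs : ∀ b, χ (of a b) = ψ b := fun b => by rw [← hχ]; rfl
    cases o with
    | some b => exact hs b
    | none =>
      have h1 : ψ a * χ (Presented.mk _ (.gen none)) = 1 := by
        rw [← hs, ← map_mul, of_mul_inv, map_one]
      change χ (Presented.mk _ (.gen none)) = c
      calc χ (Presented.mk _ (.gen none)) = (ψ a * c) * χ (Presented.mk _ (.gen none)) := by
            rw [hc, one_mul]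
        _ = c * (ψ a * χ (Presented.mk _ (.gen none))) := by ring
        _ = c := by rw [h1, mul_one]

end Loc

theorem Hom.subsingleton {A B : Type u} [CInftyRing A] [CInftyRing B] (φ : A →∞ B)
    [Subsingleton A] : Subsingleton B := by
  refine subsingleton_of_zero_eq_one ?_
  rw [← map_zero φ, ← map_one φ, Subsingleton.elim (0 : A) 1]

theorem loc_subsingleton_iff {A : Type u} [CInftyRing A] (a : A) :
    Subsingleton (Loc A a) ↔
      ∀ (C : Type u) [CInftyRing C] (ψ : A →∞ C), IsUnit (ψ a) → Subsingleton C := by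
  constructor
  · intro h C _ ψ hψ
    obtain ⟨χ, -, -⟩ := (Loc.isLoc a).2 C ψ hψ
    exact χ.subsingleton
  · intro h
    exact h _ (Loc.of a) (Loc.isLoc a).1

theorem loc_quot_subsingleton_iff {A : Type u} [CInftyRing A] (I : Ideal A) (a : A) :
    Subsingleton (Loc (A ⧸ I) (quotMk I a)) ↔
      ∀ (C : Type u) [CInftyRing C] (ψ : A →∞ C), (∀ b ∈ I, ψ b = 0) → IsUnit (ψ a) →
        Subsingleton C := by
  rw [loc_subsingleton_iff]
  constructor
  · intro h C _ ψ hI hψ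
    exact h C (quotLift ψ hI) hψ
  · intro h C _ ψ hψ
    refine h C (ψ.comp (quotMk I)) (fun b hb => ?_) hψ
    rw [Hom.comp_apply, quotMk_apply, Ideal.Quotient.eq_zero_iff_mem.2 hb, map_zero]

/-- The `∞`-radical of an ideal `I`: all `a` with `(A ⧸ I){a⁻¹} = 0`. -/
def inftyRadical {A : Type u} [CInftyRing A] (I : Ideal A) : Ideal A where
  carrier := {a | Subsingleton (Loc (A ⧸ I) (quotMk I a))}
  zero_mem' := by
    rw [Set.mem_ofPred_eq, loc_quot_subsingleton_iff]
    intro C _ ψ _ h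
    rw [map_zero] at h
    exact subsingleton_of_zero_eq_one (isUnit_zero_iff.1 h)
  add_mem' {a b} ha hb := by
    rw [Set.mem_ofPred_eq, loc_quot_subsingleton_iff] at *
    intro C _ ψ hI hu
    by_contra hC
    rw [not_subsingleton_iff_nontrivial] at hC
    obtain ⟨M, hM⟩ := Ideal.exists_maximal C
    let _ := Ideal.Quotient.field M
    have key : ∀ c, (∀ (C : Type u) [CInftyRing C] (ψ : A →∞ C), (∀ b ∈ I, ψ b = 0) →
        IsUnit (ψ c) → Subsingleton C) → ψ c ∈ M := fun c hc => by
      by_contra hcM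
      have h1 : ((quotMk M).comp ψ) c ≠ 0 := fun h0 => hcM (Ideal.Quotient.eq_zero_iff_mem.1 h0)
      have h2 := hc (C ⧸ M) ((quotMk M).comp ψ)
        (fun b hb => by rw [Hom.comp_apply, hI b hb, map_zero]) (isUnit_iff_ne_zero.2 h1)
      exact h1 (Subsingleton.elim _ _)
    refine hM.ne_top (Ideal.eq_top_of_isUnit_mem M ?_ hu)
    rw [map_add]
    exact M.add_mem (key a ha) (key b hb)
  smul_mem' c a ha := by
    rw [Set.mem_ofPred_eq, loc_quot_subsingleton_iff] at *
    intro C _ ψ hI hu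
    rw [smul_eq_mul, map_mul] at hu
    exact ha C ψ hI (isUnit_of_mul_isUnit_right hu)

theorem mem_inftyRadical {A : Type u} [CInftyRing A] {I : Ideal A} {a : A} :
    a ∈ inftyRadical I ↔ ∀ (C : Type u) [CInftyRing C] (ψ : A →∞ C),
      (∀ b ∈ I, ψ b = 0) → IsUnit (ψ a) → Subsingleton C :=
  loc_quot_subsingleton_iff I a


/-! Radicals, reductions, injectivity. -/

/-- A functorial radical operation on ideals of `C^∞`-rings. Both the nilradical and the
`∞`-radical are instances, see `nilRad` and `inftyRad`. -/
structure Radical where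
  rad : ∀ {A : Type u} [CInftyRing A], Ideal A → Ideal A
  le_rad : ∀ {A : Type u} [CInftyRing A] (I : Ideal A), I ≤ rad I
  rad_le_comap : ∀ {A B : Type u} [CInftyRing A] [CInftyRing B] (φ : A →∞ B) {I : Ideal A}
    {J : Ideal B}, (∀ a ∈ I, φ a ∈ J) → ∀ a ∈ rad I, φ a ∈ rad J

/-- The nilradical of an ideal. -/
def nilRad : Radical.{u} where
  rad I := I.radical
  le_rad _ := Ideal.le_radical
  rad_le_comap {_ _ _ _} φ {I J} h a ha := by
    obtain ⟨n, hn⟩ := ha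
    exact ⟨n, by rw [← map_pow]; exact h _ hn⟩

/-- The `∞`-radical of an ideal. -/
def inftyRad : Radical.{u} where
  rad I := inftyRadical I
  le_rad I a ha := mem_inftyRadical.2 fun C _ ψ hI hu => by
    rw [hI a ha] at hu
    exact subsingleton_of_zero_eq_one (isUnit_zero_iff.1 hu)
  rad_le_comap {_ _ _ _} φ {I J} h a ha := mem_inftyRadical.2 fun C _ ψ hJ hu =>
    mem_inftyRadical.1 ha C (ψ.comp φ) (fun b hb => hJ _ (h b hb)) hu

namespace Radical

variable (R : Radical.{u})

/-- The reduction `A ⧸ √0`. -/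
abbrev Red (A : Type u) [CInftyRing A] : Type u := A ⧸ (R.rad (⊥ : Ideal A))

/-- The unit `A → A ⧸ √0`. -/
noncomputable def unit (A : Type u) [CInftyRing A] : A →∞ R.Red A := quotMk _

variable {A B C : Type u} [CInftyRing A] [CInftyRing B] [CInftyRing C]

/-- Functoriality of the reduction. -/
noncomputable def redMap (φ : A →∞ B) : R.Red A →∞ R.Red B :=
  quotLift ((R.unit B).comp φ) fun a ha =>
    Ideal.Quotient.eq_zero_iff_mem.2 (R.rad_le_comap φ (I := ⊥) (J := ⊥)
      (fun b hb => by rw [Ideal.mem_bot] at hb ⊢; rw [hb, map_zero]) a ha)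

theorem redMap_comp_unit (φ : A →∞ B) : (R.redMap φ).comp (R.unit A) = (R.unit B).comp φ := by
  ext a; rfl

theorem red_hom_ext {φ ψ : R.Red A →∞ B} (h : φ.comp (R.unit A) = ψ.comp (R.unit A)) : φ = ψ := by
  ext q
  obtain ⟨a, rfl⟩ := Ideal.Quotient.mk_surjective q
  exact DFunLike.congr_fun h a

/-- The space `X` with `C^∞(X) = A` is injective with respect to the reduction: every morphism
`A → B ⧸ √0` lifts to `A → B`. -/
def IsInjective (A : Type u) [CInftyRing A] : Prop :=
  ∀ (B : Type u) [CInftyRing B] (φ : A →∞ R.Red B), ∃ ψ : A →∞ B, (R.unit B).comp ψ = φ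

/-- The tuple `x` is a `B`-valued point of the infinitesimal neighbourhood of the main diagonal in
`X^m`: the associated morphism out of `C^∞(X^m)` vanishes on some ideal `I` with the same radical
as the ideal of the diagonal. Equivalently, it is continuous for the discrete topology on `B` and
the linear topology on `C^∞(X^m)` defined by the ideals `I`. -/
def IsNear {m : ℕ} (x : Fin m → (A →∞ B)) : Prop :=
  ∃ I : Ideal (Copower A m), R.rad I = R.rad (Copower.diagIdeal A m) ∧
    ∀ c ∈ I, Copower.lift x c = 0

theorem IsNear.postcomp {m : ℕ} {x : Fin m → (A →∞ B)} (h : R.IsNear x) (φ : B →∞ C) :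
    R.IsNear fun i => φ.comp (x i) := by
  obtain ⟨I, hI, hx⟩ := h
  refine ⟨I, hI, fun c hc => ?_⟩
  have : Copower.lift (fun i => φ.comp (x i)) = φ.comp (Copower.lift x) :=
    Copower.hom_ext fun _ _ => rfl
  rw [this, Hom.comp_apply, hx c hc, map_zero]

theorem IsNear.unit_comp_eq {m : ℕ} {x : Fin m → (A →∞ B)} (h : R.IsNear x) (i j : Fin m) :
    (R.unit B).comp (x i) = (R.unit B).comp (x j) := by
  obtain ⟨I, hI, hx⟩ := h
  ext a
  refine Ideal.Quotient.eq.2 ?_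
  have h1 : Copower.incl i a - Copower.incl j a ∈ R.rad I := by
    rw [hI]
    refine R.le_rad _ ?_
    rw [Copower.diagIdeal, RingHom.mem_ker]
    change Copower.lift (fun _ : Fin m => Hom.id A) (_ - _) = 0
    rw [map_sub, Copower.lift_incl, Copower.lift_incl, sub_self]
  have h2 := R.rad_le_comap (Copower.lift x) (J := ⊥)
    (fun c hc => Ideal.mem_bot.2 (hx c hc)) _ h1
  rwa [map_sub, Copower.lift_incl, Copower.lift_incl] at h2

end Radical

/-! The Zariski site. -/

/-- Finitely generated `C^∞`-rings: quotients of some `C^∞(ℝⁿ)`. -/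
def IsFinGen (A : Type u) [CInftyRing A] : Prop :=
  ∃ (n : ℕ) (a : Fin n → A), ∀ b : A, ∃ f : SmoothFn n, op f a = b

/-- The spectrum of a finitely generated `C^∞`-ring. -/
structure FGScheme : Type (u + 1) where
  ring : Type u
  [str : CInftyRing ring]
  finGen : IsFinGen ring

attribute [instance] FGScheme.str

open CategoryTheory Opposite Simplicial

/-- The opposite of the category of finitely generated `C^∞`-rings. -/
instance : Category.{u} FGScheme.{u} where
  Hom Z W := W.ring →∞ Z.ring
  id Z := Hom.id Z.ring
  comp f g := Hom.comp f g

/-- The ring homomorphism corresponding to a morphism of spectra. -/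
def FGScheme.pullback {Z W : FGScheme.{u}} (f : Z ⟶ W) : W.ring →∞ Z.ring := f

/-- The Zariski covering families: finite families of localizations at elements that generate the
unit ideal. -/
def zariskiPrecoverage : Precoverage FGScheme.{u} where
  coverings Z := {S | ∃ (k : ℕ) (Y : Fin k → FGScheme.{u}) (f : ∀ i, Y i ⟶ Z) (a : Fin k → Z.ring),
    (∀ i, IsLoc (a i) (FGScheme.pullback (f i))) ∧ Ideal.span (Set.range a) = ⊤ ∧
      S = Presieve.ofArrows Y f}

/-- The Zariski topology. -/
def zariski : GrothendieckTopology FGScheme.{u} := zariskiPrecoverage.toGrothendieck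

/-! De Rham spaces and de Rham groupoids. -/

/-- The de Rham space of `X`: the presheaf `Z ↦ Hom(Z_red, X)`. -/
noncomputable def deRhamSpace (R : Radical.{u}) (A : Type u) [CInftyRing A] :
    FGScheme.{u}ᵒᵖ ⥤ Type u where
  obj Z := A →∞ R.Red Z.unop.ring
  map f := ↾fun x => (R.redMap (FGScheme.pullback f.unop)).comp x
  map_id Z := by
    refine ConcreteCategory.hom_ext _ _ fun x => ?_
    change (R.redMap (Hom.id Z.unop.ring)).comp x = x
    have : R.redMap (Hom.id Z.unop.ring) = Hom.id _ := R.red_hom_ext (by ext; rfl)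
    rw [this]; rfl
  map_comp f g := by
    refine ConcreteCategory.hom_ext _ _ fun x => ?_
    change (R.redMap ((FGScheme.pullback g.unop).comp (FGScheme.pullback f.unop))).comp x =
      (R.redMap (FGScheme.pullback g.unop)).comp ((R.redMap (FGScheme.pullback f.unop)).comp x)
    have : R.redMap ((FGScheme.pullback g.unop).comp (FGScheme.pullback f.unop)) =
        (R.redMap (FGScheme.pullback g.unop)).comp (R.redMap (FGScheme.pullback f.unop)) :=
      R.red_hom_ext (by ext; rfl)
    rw [this]; rfl

/-- The infinitesimal neighbourhood of the diagonal in `X × X` is a subgroupoid of the pair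
groupoid of `X`, and the infinitesimal neighbourhoods of the main diagonals in the powers `X^{k+1}`
form its nerve: a `(k+1)`-tuple of points of `X` belongs to the `k`-th one if and only if the
consecutive pairs are morphisms of the groupoid. -/
structure FormsGroupoid (R : Radical.{u}) (A : Type u) [CInftyRing A] : Prop where
  refl : ∀ (Z : FGScheme.{u}) (x : A →∞ Z.ring), R.IsNear ![x, x]
  symm : ∀ (Z : FGScheme.{u}) (x y : A →∞ Z.ring), R.IsNear ![x, y] → R.IsNear ![y, x]
  trans : ∀ (Z : FGScheme.{u}) (x y z : A →∞ Z.ring),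
    R.IsNear ![x, y] → R.IsNear ![y, z] → R.IsNear ![x, z]
  isNear_iff : ∀ (Z : FGScheme.{u}) (k : ℕ) (x : Fin (k + 1) → (A →∞ Z.ring)),
    R.IsNear x ↔ ∀ i : Fin k, R.IsNear ![x i.castSucc, x i.succ]

theorem FormsGroupoid.isNear_pair {R : Radical.{u}} {A : Type u} [CInftyRing A]
    (h : FormsGroupoid R A) {Z : FGScheme.{u}} {k : ℕ} {x : Fin (k + 1) → (A →∞ Z.ring)}
    (hx : R.IsNear x) {i j : Fin (k + 1)} (hij : i ≤ j) : R.IsNear ![x i, x j] := by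
  induction j using Fin.induction with
  | zero =>
    obtain rfl : i = 0 := le_antisymm hij (Fin.zero_le _)
    exact h.refl _ _
  | succ j ih =>
    rcases hij.eq_or_lt with rfl | hlt
    · exact h.refl _ _
    · exact h.trans _ _ _ _ (ih (Fin.le_castSucc_iff.2 hlt)) ((h.isNear_iff Z k x).1 hx j)

theorem FormsGroupoid.isNear_comp {R : Radical.{u}} {A : Type u} [CInftyRing A]
    (h : FormsGroupoid R A) {Z : FGScheme.{u}} {k l : ℕ} {x : Fin (k + 1) → (A →∞ Z.ring)}
    (hx : R.IsNear x) (θ : Fin (l + 1) →o Fin (k + 1)) : R.IsNear fun i => x (θ i) :=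
  (h.isNear_iff Z l _).2 fun i => h.isNear_pair hx (θ.monotone (Fin.castSucc_le_succ i))

/-- The nerve of the de Rham groupoid of `X`, a simplicial presheaf: its `k`-simplices form the
infinitesimal neighbourhood of the main diagonal in `X^{k+1}`, and the simplicial operators are the
projections and diagonals of the powers of `X`. -/
def deRhamNerve (R : Radical.{u}) (A : Type u) [CInftyRing A] (h : FormsGroupoid R A) :
    FGScheme.{u}ᵒᵖ ⥤ SSet.{u} where
  obj Z :=
    { obj := fun k => {x : Fin (k.unop.len + 1) → (A →∞ Z.unop.ring) // R.IsNear x}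
      map := fun θ => ↾fun x => ⟨fun i => x.1 (θ.unop.toOrderHom i), h.isNear_comp x.2 _⟩ }
  map f :=
    { app := fun _ => ↾fun x =>
        ⟨fun i => (FGScheme.pullback f.unop).comp (x.1 i), x.2.postcomp R _⟩ }

/-- A presheaf of sets as a constant simplicial presheaf. -/
abbrev constSimplicial {C : Type*} [Category* C] (P : Cᵒᵖ ⥤ Type u) : Cᵒᵖ ⥤ SSet.{u} :=
  P ⋙ SimplicialObject.const (Type u)

/-- The canonical morphism from the nerve of the de Rham groupoid to the de Rham space: it is
induced by `X → X_dR`, and sends a simplex to the common image of its vertices. -/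
noncomputable def nerveToDeRham (R : Radical.{u}) (A : Type u) [CInftyRing A]
    (h : FormsGroupoid R A) : deRhamNerve R A h ⟶ constSimplicial (deRhamSpace R A) where
  app Z :=
    { app := fun _ => ↾fun x => (R.unit Z.unop.ring).comp (x.1 0)
      naturality := fun k l θ => by
        refine ConcreteCategory.hom_ext _ _ fun x => ?_
        exact x.2.unit_comp_eq R _ _ }

/-! Weak equivalences of simplicial sets and of simplicial presheaves. -/

section HomotopyGroups

open scoped Topology

/-- The map on homotopy groups induced by a pointed map. -/
def homotopyGroupMap (n : ℕ) {X Y : Type*} [TopologicalSpace X] [TopologicalSpace Y] (f : C(X, Y))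
    {x : X} {y : Y} (h : f x = y) : HomotopyGroup.Pi n X x → HomotopyGroup.Pi n Y y :=
  Quotient.map
    (fun γ => ⟨f.comp γ.1, fun t ht => (congrArg f (γ.2 t ht)).trans h⟩)
    (fun _ _ H => H.map fun K => K.compContinuousMap f)

/-- The point of the geometric realization that corresponds to a vertex. -/
noncomputable def realizationPt {X : SSet.{u}} (x : X _⦋0⦌) : SSet.toTop.obj X :=
  TopCat.toSSetObj₀Equiv ((sSetTopAdj.unit.app X).app (op ⦋0⦌) x)

theorem realizationPt_map {X Y : SSet.{u}} (f : X ⟶ Y) (x : X _⦋0⦌) :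
    SSet.toTop.map f (realizationPt x) = realizationPt (f.app _ x) := by
  have := ConcreteCategory.congr_hom
    (congrArg (fun α => NatTrans.app α (op ⦋0⦌)) (sSetTopAdj.unit.naturality f)) x
  refine Eq.trans ?_ (congrArg TopCat.toSSetObj₀Equiv this.symm)
  rfl

/-- The `n`-th homotopy group of a simplicial set at a vertex, defined as the homotopy group of the
geometric realization. -/
def sPi (n : ℕ) (X : SSet.{u}) (x : X _⦋0⦌) : Type u :=
  HomotopyGroup.Pi n (SSet.toTop.obj X) (realizationPt x)

/-- The map on homotopy groups induced by a pointed map of simplicial sets. -/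
noncomputable def sPiMap (n : ℕ) {X Y : SSet.{u}} (f : X ⟶ Y) {x : X _⦋0⦌} {y : Y _⦋0⦌} (h : f.app _ x = y) :
    sPi n X x → sPi n Y y :=
  homotopyGroupMap n (SSet.toTop.map f).hom (by
    subst h
    exact realizationPt_map f x)

theorem sPiMap_id (n : ℕ) {X : SSet.{u}} {f : X ⟶ X} (hf : f = 𝟙 X) {x : X _⦋0⦌}
    (h : f.app _ x = x) (c : sPi n X x) : sPiMap n f h c = c := by
  subst hf
  induction c using Quotient.inductionOn with
  | h γ =>
    refine congrArg (Quotient.mk _) (Subtype.ext (ContinuousMap.ext fun t => ?_))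
    change SSet.toTop.map (𝟙 X) (γ.1 t) = γ.1 t
    rw [CategoryTheory.Functor.map_id]; rfl

theorem sPiMap_comp (n : ℕ) {X Y Z : SSet.{u}} {f : X ⟶ Y} {g : Y ⟶ Z} {e : X ⟶ Z} (he : e = f ≫ g)
    {x : X _⦋0⦌} {y : Y _⦋0⦌} {z : Z _⦋0⦌} (hf : f.app _ x = y) (hg : g.app _ y = z)
    (h : e.app _ x = z) (c : sPi n X x) : sPiMap n e h c = sPiMap n g hg (sPiMap n f hf c) := by
  subst he
  induction c using Quotient.inductionOn with
  | h γ =>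
    refine congrArg (Quotient.mk _) (Subtype.ext (ContinuousMap.ext fun t => ?_))
    change SSet.toTop.map (f ≫ g) (γ.1 t) = SSet.toTop.map g (SSet.toTop.map f (γ.1 t))
    rw [CategoryTheory.Functor.map_comp]; rfl

/-- A morphism of simplicial sets is a weak equivalence if it induces a bijection on connected
components and, for every vertex of the source, isomorphisms on all homotopy groups. -/
def IsWeakEquivalence {X Y : SSet.{u}} (f : X ⟶ Y) : Prop :=
  Function.Bijective (SSet.mapπ₀ f) ∧
    ∀ (n : ℕ) (x : X _⦋0⦌), Function.Bijective (sPiMap (n + 1) f (x := x) rfl)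

section Presheaves

variable {C : Type*} [Category* C]

/-- Global (objectwise) weak equivalences of simplicial presheaves. -/
def IsGlobalWeakEquivalence {F G : Cᵒᵖ ⥤ SSet.{u}} (f : F ⟶ G) : Prop :=
  ∀ Z, IsWeakEquivalence (f.app Z)

theorem restrict_vertex (F : Cᵒᵖ ⥤ SSet.{u}) {Z : C} (x : (F.obj (op Z)) _⦋0⦌) {V W : (Over Z)ᵒᵖ}
    (g : V ⟶ W) : (F.map g.unop.left.op).app _ ((F.map V.unop.hom.op).app _ x) =
      (F.map W.unop.hom.op).app _ x := by
  rw [← Over.w g.unop, op_comp, CategoryTheory.Functor.map_comp]; rfl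

theorem app_restrict_vertex {F G : Cᵒᵖ ⥤ SSet.{u}} (f : F ⟶ G) {Z : C} (x : (F.obj (op Z)) _⦋0⦌)
    (V : Over Z) : (f.app (op V.left)).app _ ((F.map V.hom.op).app _ x) =
      (G.map V.hom.op).app _ ((f.app (op Z)).app _ x) :=
  ConcreteCategory.congr_hom (congrArg (fun α => NatTrans.app α (op ⦋0⦌)) (f.naturality V.hom.op)) x

/-- The presheaf of `n`-th homotopy groups of `F` on the category of objects over `Z`, for a vertex
of `F` over `Z`. -/
noncomputable def piPresheaf (n : ℕ) (F : Cᵒᵖ ⥤ SSet.{u}) {Z : C} (x : (F.obj (op Z)) _⦋0⦌) :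
    (Over Z)ᵒᵖ ⥤ Type u where
  obj V := sPi n (F.obj (op V.unop.left)) ((F.map V.unop.hom.op).app _ x)
  map g := ↾sPiMap n (F.map g.unop.left.op) (restrict_vertex F x g)
  map_id V := ConcreteCategory.hom_ext _ _ fun c =>
    sPiMap_id n (F.map_id (op V.unop.left)) (restrict_vertex F x (𝟙 V)) c
  map_comp {V W U} g h := ConcreteCategory.hom_ext _ _ fun c =>
    sPiMap_comp n (F.map_comp g.unop.left.op h.unop.left.op) (restrict_vertex F x g)
      (restrict_vertex F x h) (restrict_vertex F x (g ≫ h)) c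

/-- The morphism on presheaves of homotopy groups induced by a morphism of simplicial presheaves. -/
noncomputable def piPresheafMap (n : ℕ) {F G : Cᵒᵖ ⥤ SSet.{u}} (f : F ⟶ G) {Z : C}
    (x : (F.obj (op Z)) _⦋0⦌) :
    piPresheaf n F x ⟶ piPresheaf n G ((f.app (op Z)).app _ x) where
  app V := ↾sPiMap n (f.app (op V.unop.left)) (app_restrict_vertex f x V.unop)
  naturality V W g := ConcreteCategory.hom_ext _ _ fun c => by
    have h : (F.map g.unop.left.op ≫ f.app (op W.unop.left)).app _
        ((F.map V.unop.hom.op).app _ x) =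
        (G.map W.unop.hom.op).app _ ((f.app (op Z)).app _ x) :=
      (congrArg ((f.app (op W.unop.left)).app _) (restrict_vertex F x g)).trans
        (app_restrict_vertex f x W.unop)
    exact (sPiMap_comp n rfl (restrict_vertex F x g) (app_restrict_vertex f x W.unop) h c).symm.trans
      (sPiMap_comp n (f.naturality g.unop.left.op) (app_restrict_vertex f x V.unop)
        (restrict_vertex G _ g) h c)

/-- Local weak equivalences of simplicial presheaves on a site: the morphisms that induce
isomorphisms of the sheaves of connected components and, for every object `Z` and every vertex over
`Z`, of the sheaves of homotopy groups on the objects over `Z`. Here `J.W` is the class of morphisms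
of presheaves that become isomorphisms after sheafification. -/
def IsLocalWeakEquivalence (J : GrothendieckTopology C) {F G : Cᵒᵖ ⥤ SSet.{u}} (f : F ⟶ G) : Prop :=
  J.W (Functor.whiskerRight f SSet.π₀Functor) ∧
    ∀ (n : ℕ) (Z : C) (x : (F.obj (op Z)) _⦋0⦌), (J.over Z).W (piPresheafMap (n + 1) f x)

end Presheaves

end HomotopyGroups

end CInf

/-! Over a finitely generated ring, a nonempty tuple of points of `X` lies in the infinitesimal
neighbourhood of the diagonal exactly when all its entries have the same reduction
(`Radical.IsGood.isNear_iff`). Hence the groupoid is, on sections, the kernel pair of `X → X_dR`, an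
equivalence relation, and the description of its nerve is immediate. Injectivity makes `X(Z) →
X_dR(Z)` surjective, so the nerve over `Z` is a disjoint union of contractible pieces, one for each
element of `X_dR(Z)`. This is the global equivalence. The local one follows because objectwise
bijections of presheaves stay isomorphisms after sheafification.

The hard half of the criterion must produce an ideal with the radical of the diagonal ideal on which
the tuple vanishes. The candidate is the diagonal ideal intersected with the kernel of the tuple.
Elements of the diagonal ideal become nilpotent in the chosen sense, and one needs a single equation
witnessing this. For the nilradical it is a power. For the `∞`-radical it is `h(c) = 0` with `h`
smooth and nonzero off the origin (`exists_op_eq_zero`); it comes from division of smooth functions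
(`exists_comp_eq_mul`), and `mem_inftyRadical_of_op_mem` is the converse.

Homotopy groups are those of the geometric realization, so contractibility is realized by an actual
homotopy. Prepending a chosen lift to each simplex is a cone construction (`Conical`); the straight
segments to the cone points glue to a contraction, which fixes the base point when the lift chosen
over its class is the base point itself (`Conical.subsingleton_sPi`). -/

namespace CInf

/-! ### Smooth series and division of smooth functions -/

/-- Any sequence of smooth functions can be scaled down so that its sum is smooth. -/
theorem exists_smooth_tsum {E : Type} [NormedAddCommGroup E] [NormedSpace ℝ E]
    [FiniteDimensional ℝ E] (u : ℕ → E → ℝ) (hu : ∀ k, ContDiff ℝ ∞ (u k)) :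
    ∃ δ : ℕ → ℝ, (∀ k, 0 < δ k) ∧ ∀ ε : ℕ → ℝ, (∀ k, 0 ≤ ε k) → (∀ k, ε k ≤ δ k) →
      ContDiff ℝ ∞ (fun x => ∑' k, ε k * u k x) ∧ ∀ x, Summable fun k => ε k * u k x := by
  -- Cutoffs equal to 1 on the ball of radius `R + 1` make every derivative globally bounded without
  -- changing the functions there.
  let φ : ℕ → ContDiffBump (0 : E) := fun R => ⟨R + 1, R + 2, by positivity, by linarith⟩
  let v : ℕ → ℕ → E → ℝ := fun R k x => φ R x * u k x
  have hv : ∀ R k, ContDiff ℝ ∞ (v R k) := fun R k => (φ R).contDiff.mul (hu k)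
  have hsupp : ∀ R k, HasCompactSupport (v R k) := fun R k => (φ R).hasCompactSupport.mul_right
  have hb : ∀ R j k, ∃ c : ℝ, ∀ x, ‖iteratedFDeriv ℝ j (v R k) x‖ ≤ c := fun R j k =>
    ((hsupp R k).iteratedFDeriv j).exists_bound_of_continuous
      ((hv R k).continuous_iteratedFDeriv (by exact_mod_cast le_top))
  choose c hc using hb
  have hc0 : ∀ R j k, 0 ≤ c R j k := fun R j k => (norm_nonneg _).trans (hc R j k 0)
  -- Diagonal choice: `S k` dominates the bounds for all `R, j ≤ k`, so for fixed `R` and `j` all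
  -- but finitely many terms of the scaled series are at most `(1 / 2) ^ k`.
  let S : ℕ → ℝ := fun k => ∑ R ∈ Finset.range (k + 1), ∑ j ∈ Finset.range (k + 1), c R j k
  have hS0 : ∀ k, 0 ≤ S k := fun k =>
    Finset.sum_nonneg fun R _ => Finset.sum_nonneg fun j _ => hc0 R j k
  have hcS : ∀ R j k, R ≤ k → j ≤ k → c R j k ≤ S k := fun R j k hR hj =>
    (Finset.single_le_sum (f := fun j => c R j k) (fun j _ => hc0 R j k)
      (Finset.mem_range.2 (Nat.lt_succ_of_le hj))).trans
    (Finset.single_le_sum (f := fun R => ∑ j ∈ Finset.range (k + 1), c R j k)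
      (fun R _ => Finset.sum_nonneg fun j _ => hc0 R j k)
      (Finset.mem_range.2 (Nat.lt_succ_of_le hR)))
  refine ⟨fun k => (1 / 2) ^ k / (1 + S k), fun k => div_pos (by positivity)
    (by linarith [hS0 k]), fun ε hε0 hεδ => ?_⟩
  have hbound : ∀ R j k, R ≤ k → j ≤ k → ∀ x,
      ‖iteratedFDeriv ℝ j (fun x => ε k * v R k x) x‖ ≤ (1 / 2) ^ k := by
    intro R j k hR hj x
    have h1 : iteratedFDeriv ℝ j (fun x => ε k * v R k x) x =
        ε k • iteratedFDeriv ℝ j (v R k) x :=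
      iteratedFDeriv_const_smul_apply (a := ε k) (((hv R k).of_le (by exact_mod_cast le_top)).contDiffAt)
    rw [h1, norm_smul, Real.norm_of_nonneg (hε0 k)]
    have h2 : 0 < 1 + S k := by linarith [hS0 k]
    calc ε k * ‖iteratedFDeriv ℝ j (v R k) x‖ ≤ (1 / 2) ^ k / (1 + S k) * (1 + S k) := by
          refine mul_le_mul (hεδ k) ?_ (norm_nonneg _) (by positivity)
          linarith [hc R j k x, hcS R j k hR hj]
      _ = (1 / 2) ^ k := by field_simp
  have hsum : Summable fun k : ℕ => (1 / 2 : ℝ) ^ k := summable_geometric_two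
  have hφ : ∀ (R : ℕ) x, ‖x‖ < (R : ℝ) + 1 → ∀ k, v R k x = u k x := fun R x hx k => by
    have : φ R x = 1 := (φ R).one_of_mem_closedBall (by
      rw [mem_closedBall_zero_iff]; exact hx.le)
    simp [v, this]
  have hR : ∀ x : E, ∃ R : ℕ, ‖x‖ < (R : ℝ) + 1 := fun x => by
    obtain ⟨R, hR⟩ := exists_nat_gt ‖x‖
    exact ⟨R, by linarith⟩
  constructor
  · rw [contDiff_iff_contDiffAt]
    intro x
    obtain ⟨R, hx⟩ := hR x
    have h3 : ContDiff ℝ ∞ fun x => ∑' k, ε k * v R k x := by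
      refine contDiff_tsum_of_eventually (v := fun _ k => (1 / 2 : ℝ) ^ k)
        (fun k => contDiff_const.mul (hv R k)) (fun _ _ => hsum) fun j _ => ?_
      rw [Nat.cofinite_eq_atTop]
      filter_upwards [Filter.eventually_ge_atTop (max R j)] with k hk
      exact hbound R j k (le_of_max_le_left hk) (le_of_max_le_right hk)
    refine h3.contDiffAt.congr_of_eventuallyEq ?_
    filter_upwards [(isOpen_lt continuous_norm continuous_const).mem_nhds hx] with y hy
    exact tsum_congr fun k => by rw [hφ R y hy k]
  · intro x
    obtain ⟨R, hx⟩ := hR x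
    refine Summable.of_norm_bounded_eventually_nat hsum ?_
    filter_upwards [Filter.eventually_ge_atTop R] with k hk
    have := hbound R 0 k hk (Nat.zero_le _) x
    rw [norm_iteratedFDeriv_zero] at this
    rwa [hφ R x hx k] at this

/-- If `f` vanishes where `g` does, then `g` divides `h ∘ f` for some smooth `h : ℝ → ℝ` that does
not vanish outside the origin. -/
theorem exists_comp_eq_mul {n : ℕ} (f g : SmoothFn n) (hfg : ∀ x, g.1 x = 0 → f.1 x = 0) :
    ∃ h : SmoothFn 1, (∀ t, t 0 ≠ 0 → h.1 t ≠ 0) ∧ ∃ q, (h.comp fun _ => f) = g * q := by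
  have hf := mem_smoothSubring.1 f.2
  have hg := mem_smoothSubring.1 g.2
  -- `χ k` vanishes for `|t| ≤ 1 / (k + 1)` and is positive beyond. Near a zero of `g` the values of
  -- `f` are small, so `χ k ∘ f` is zero in a neighbourhood and the quotient by `g` is smooth.
  let χ : ℕ → ℝ → ℝ := fun k t => expNegInvGlue (t ^ 2 - (1 / ((k : ℝ) + 1)) ^ 2)
  have hχ : ∀ k, ContDiff ℝ ∞ (χ k) := fun k => expNegInvGlue.contDiff.comp (by fun_prop)
  let q : ℕ → (Fin n → ℝ) → ℝ := fun k x => χ k (f.1 x) / g.1 x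
  have hq : ∀ k, ContDiff ℝ ∞ (q k) := fun k => by
    rw [contDiff_iff_contDiffAt]
    intro x
    by_cases hx : g.1 x = 0
    · have h0 : f.1 x ^ 2 < (1 / ((k : ℝ) + 1)) ^ 2 := by
        rw [hfg x hx, zero_pow two_ne_zero]; positivity
      refine (contDiffAt_const (c := (0 : ℝ))).congr_of_eventuallyEq ?_
      filter_upwards [(isOpen_lt (hf.continuous.pow 2) continuous_const).mem_nhds h0] with y hy
      have : χ k (f.1 y) = 0 := expNegInvGlue.zero_of_nonpos (sub_nonpos.2 (le_of_lt hy))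
      simp [q, this]
    · exact ((hχ k).comp hf).contDiffAt.div hg.contDiffAt hx
  have hgq : ∀ k x, g.1 x * q k x = χ k (f.1 x) := fun k x => by
    by_cases hx : g.1 x = 0
    · have : χ k (f.1 x) = 0 := expNegInvGlue.zero_of_nonpos (by
        rw [hfg x hx, zero_pow two_ne_zero, zero_sub, neg_nonpos]; positivity)
      rw [this, hx, zero_mul]
    · exact mul_div_cancel₀ _ hx
  obtain ⟨δ₁, hδ₁, h₁⟩ := exists_smooth_tsum χ hχ
  obtain ⟨δ₂, hδ₂, h₂⟩ := exists_smooth_tsum q hq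
  -- One sequence of weights must make both series smooth, so that the identity `χ k ∘ f = g * q k`
  -- can be summed termwise.
  let ε : ℕ → ℝ := fun k => min (δ₁ k) (δ₂ k)
  have hε : ∀ k, 0 < ε k := fun k => lt_min (hδ₁ k) (hδ₂ k)
  obtain ⟨hc₁, hs₁⟩ := h₁ ε (fun k => (hε k).le) fun k => min_le_left _ _
  obtain ⟨hc₂, -⟩ := h₂ ε (fun k => (hε k).le) fun k => min_le_right _ _
  refine ⟨⟨fun t => ∑' k, ε k * χ k (t 0), mem_smoothSubring.2 (hc₁.comp (contDiff_apply ℝ ℝ 0))⟩,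
    fun t ht => ?_, ⟨fun x => ∑' k, ε k * q k x, mem_smoothSubring.2 hc₂⟩, ?_⟩
  · have hnn : ∀ k, 0 ≤ ε k * χ k (t 0) := fun k =>
      mul_nonneg (hε k).le (expNegInvGlue.nonneg _)
    obtain ⟨k, hk⟩ := exists_nat_one_div_lt (abs_pos.2 ht)
    refine ((hs₁ (t 0)).tsum_pos hnn k (mul_pos (hε k) (expNegInvGlue.pos_of_pos ?_))).ne'
    rw [sub_pos, ← sq_abs (t 0)]
    exact pow_lt_pow_left₀ hk (by positivity) two_ne_zero
  · refine Subtype.ext (funext fun x => ?_)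
    change ∑' k, ε k * χ k (f.1 x) = g.1 x * ∑' k, ε k * q k x
    rw [← tsum_mul_left]
    exact tsum_congr fun k => by rw [← hgq k x]; ring

/-! ### The `∞`-radical by equations -/

open CInftyRing (op)

/-- Smooth functions form a `C^∞`-ring under composition. -/
noncomputable instance (n : ℕ) : CInftyRing (ULift.{u} (SmoothFn n)) where
  op f a := ⟨f.comp fun i => (a i).down⟩
  op_proj _ _ := rfl
  op_comp _ _ _ := rfl
  op_addFn _ := rfl
  op_mulFn _ := rfl

/-- Inverting `op f a` kills the quotient of `C^∞(ℝⁿ)` by the relations of `a` only if `f` vanishes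
on the zero set of some relation. -/
theorem exists_zeros_subset {B : Type u} [CInftyRing B] {n : ℕ} (a : Fin n → B)
    (ha : ∀ b : B, ∃ f : SmoothFn n, op f a = b) (f : SmoothFn n)
    (hf : op f a ∈ inftyRadical (⊥ : Ideal B)) :
    ∃ g : SmoothFn n, op g a = 0 ∧ ∀ x, g.1 x = 0 → f.1 x = 0 := by
  choose s hs using ha
  let e : SmoothFn n → ULift.{u} (SmoothFn (n + 1)) := fun g =>
    ⟨g.comp fun i => SmoothFn.proj i.castSucc⟩
  -- The functions vanishing on a locus `g = 0`, `f * y = 1`, where `y` is the last coordinate and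
  -- `g` is some relation of `a`. Sums stay in `K` because `g² + g'²` is again a relation and cuts
  -- out the common zeros.
  let K : Ideal (ULift.{u} (SmoothFn (n + 1))) :=
    { carrier := {p | ∃ g : SmoothFn n, op g a = 0 ∧
        ∀ x : Fin (n + 1) → ℝ, g.1 (fun i => x i.castSucc) = 0 →
          f.1 (fun i => x i.castSucc) * x (Fin.last n) = 1 → p.down.1 x = 0}
      zero_mem' := ⟨0, op_zero a, fun _ _ _ => rfl⟩
      add_mem' := by
        rintro p p' ⟨g, hg, hp⟩ ⟨g', hg', hp'⟩
        refine ⟨g * g + g' * g', by rw [op_add, op_mul, op_mul, hg, hg']; simp, fun x hx hx1 => ?_⟩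
        have h0 := mul_self_add_mul_self_eq_zero.1 hx
        change p.down.1 x + p'.down.1 x = 0
        rw [hp x h0.1 hx1, hp' x h0.2 hx1, add_zero]
      smul_mem' := by
        rintro r p ⟨g, hg, hp⟩
        refine ⟨g, hg, fun x hx hx1 => ?_⟩
        change r.down.1 x * p.down.1 x = 0
        rw [hp x hx hx1, mul_zero] }
  have heK : ∀ g, op g a = 0 → e g ∈ K := fun g hg => ⟨g, hg, fun _ hx _ => hx⟩
  -- The lifts `s b` are arbitrary choices; they become compatible with the operations modulo `K`,
  -- which contains all relations of `a`.
  let ψ : B →∞ (ULift.{u} (SmoothFn (n + 1)) ⧸ K) :=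
    Hom.ofMapOp (fun b => quotMk K (e (s b))) fun {m} p b => by
      rw [← (quotMk K).map_op]
      refine Ideal.Quotient.eq.2 (heK (s (op p b) - p.comp fun i => s (b i)) ?_)
      change opHom a _ = 0
      rw [map_sub]
      change op _ a - op _ a = 0
      rw [hs, CInftyRing.op_comp]
      simp only [hs, sub_self]
  have hψ : ψ (op f a) = quotMk K (e f) := by
    refine Ideal.Quotient.eq.2 (heK (s (op f a) - f) ?_)
    change opHom a _ = 0
    rw [map_sub]
    change op _ a - op _ a = 0
    rw [hs, sub_self]
  have hu : IsUnit (ψ (op f a)) := by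
    refine IsUnit.of_mul_eq_one (quotMk K ⟨SmoothFn.proj (Fin.last n)⟩) ?_
    rw [hψ, ← map_mul, ← map_one (quotMk K)]
    refine Ideal.Quotient.eq.2 ⟨0, op_zero a, fun x _ hx => ?_⟩
    exact sub_eq_zero.2 hx
  have h1 := mem_inftyRadical.1 hf _ ψ (fun b hb => by rw [Ideal.mem_bot.1 hb, map_zero]) hu
  -- The quotient by `K` inverts the image of `op f a`, so it is zero. That `1` lies in `K` says
  -- that one of the loci is empty; a zero `x` of `g` with `f x ≠ 0` would give its point `(x, 1 / f
  -- x)`.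
  obtain ⟨g, hg, h⟩ : (1 : ULift.{u} (SmoothFn (n + 1))) ∈ K := by
    rw [← Ideal.Quotient.eq_zero_iff_mem]
    exact Subsingleton.elim _ _
  refine ⟨g, hg, fun x hx => ?_⟩
  by_contra hfx
  refine one_ne_zero (α := ℝ) (h (Fin.snoc x (f.1 x)⁻¹ : Fin (n + 1) → ℝ) ?_ ?_)
  · simpa using hx
  · simpa using mul_inv_cancel₀ hfx

/-- The `∞`-nilpotent elements of a finitely generated `C^∞`-ring are annihilated by smooth functions
that vanish at most at the origin. -/
theorem exists_op_eq_zero {B : Type u} [CInftyRing B] (hB : IsFinGen B) {c : B}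
    (hc : c ∈ inftyRadical (⊥ : Ideal B)) :
    ∃ h : SmoothFn 1, (∀ t, t 0 ≠ 0 → h.1 t ≠ 0) ∧ op h (fun _ => c) = 0 := by
  obtain ⟨n, a, ha⟩ := hB
  obtain ⟨f, rfl⟩ := ha c
  obtain ⟨g, hg, hfg⟩ := exists_zeros_subset a ha f hc
  obtain ⟨h, hh, q, hq⟩ := exists_comp_eq_mul f g hfg
  refine ⟨h, hh, ?_⟩
  rw [← CInftyRing.op_comp h (fun _ => f) a, hq, op_mul, hg, zero_mul]

/-- If `c` has an inverse `d` in a ring where `h(c) = 0`, then `(c, d)` satisfies both `h(x) = 0`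
and `x * y = 1`. These equations have no common real zero, so the sum of squares of `h(x)` and `x *
y - 1` is an invertible smooth function that takes the value 0 at `(c, d)`, which forces `1 = 0`. -/
theorem mem_inftyRadical_of_op_mem {B : Type u} [CInftyRing B] {I : Ideal B} {c : B}
    (h : SmoothFn 1) (hh : ∀ t, t 0 ≠ 0 → h.1 t ≠ 0) (hc : op h (fun _ => c) ∈ I) :
    c ∈ inftyRadical I := by
  refine mem_inftyRadical.2 fun C _ ψ hI hu => ?_
  obtain ⟨d, hd⟩ := hu.exists_right_inv
  let h₁ : SmoothFn 2 := h.comp fun _ => SmoothFn.proj 0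
  let h₂ : SmoothFn 2 := SmoothFn.mulFn - 1
  have hne : ∀ x, (h₁ * h₁ + h₂ * h₂).1 x ≠ 0 := fun x hx => by
    have h0 := mul_self_add_mul_self_eq_zero.1 hx
    refine hh (fun _ => x 0) (fun hx0 => ?_) h0.1
    have h2 : x 0 * x 1 - 1 = 0 := h0.2
    rw [hx0] at h2
    norm_num at h2
  let k : SmoothFn 2 := ⟨fun x => ((h₁ * h₁ + h₂ * h₂).1 x)⁻¹,
    mem_smoothSubring.2 ((mem_smoothSubring.1 (h₁ * h₁ + h₂ * h₂).2).inv hne)⟩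
  have hk : (h₁ * h₁ + h₂ * h₂) * k = 1 :=
    Subtype.ext (funext fun x => mul_inv_cancel₀ (hne x))
  have e₁ : op h₁ ![ψ c, d] = 0 := by
    rw [CInftyRing.op_comp]
    simp only [CInftyRing.op_proj, Matrix.cons_val_zero]
    rw [← ψ.map_op h fun _ => c]
    exact hI _ hc
  have e₂ : op h₂ ![ψ c, d] = 0 := by
    change opHom ![ψ c, d] (_ - _) = 0
    rw [map_sub, map_one]
    change op SmoothFn.mulFn _ - 1 = 0
    rw [CInftyRing.op_mulFn]
    exact sub_eq_zero.2 hd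
  have h3 := congrArg (fun p => op p ![ψ c, d]) hk
  simp only [op_mul, op_add, op_one, e₁, e₂, mul_zero, add_zero, zero_mul] at h3
  exact subsingleton_of_zero_eq_one h3

/-- In a quotient of the target by a maximal ideal, every nonzero element is a unit. A morphism to
it that kills `I` therefore kills the `∞`-radical of `I`, and hence that radical's own `∞`-radical.
-/
theorem inftyRadical_inftyRadical {B : Type u} [CInftyRing B] (I : Ideal B) :
    inftyRadical (inftyRadical I) = inftyRadical I := by
  refine le_antisymm (fun c hc => mem_inftyRadical.2 fun C _ ψ hI hu => ?_)
    (inftyRad.le_rad (inftyRadical I))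
  by_contra hC
  rw [not_subsingleton_iff_nontrivial] at hC
  obtain ⟨M, hM⟩ := Ideal.exists_maximal C
  let _ := Ideal.Quotient.field M
  have key : ∀ b ∈ inftyRadical I, ((quotMk M).comp ψ) b = 0 := fun b hb => by
    by_contra h0
    have h1 := mem_inftyRadical.1 hb (C ⧸ M) ((quotMk M).comp ψ)
      (fun b hb => by rw [Hom.comp_apply, hI b hb, map_zero]) (isUnit_iff_ne_zero.2 h0)
    exact h0 (Subsingleton.elim _ _)
  have h2 := mem_inftyRadical.1 hc (C ⧸ M) ((quotMk M).comp ψ) key (hu.map (quotMk M))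
  exact zero_ne_one (α := C ⧸ M) (Subsingleton.elim _ _)

/-! ### Nearness as equality of reductions -/

/-- Radical operations for which the infinitesimal neighbourhoods of the diagonals consist of the
tuples of points with the same reductions. -/
structure Radical.IsGood (R : Radical.{u}) : Prop where
  rad_rad : ∀ {B : Type u} [CInftyRing B] (I : Ideal B), R.rad (R.rad I) = R.rad I
  mem_rad_inf_ker : ∀ {B C : Type u} [CInftyRing B] [CInftyRing C], IsFinGen C →
    ∀ (φ : B →∞ C) (I : Ideal B), ∀ c ∈ I, φ c ∈ R.rad (⊥ : Ideal C) →
      c ∈ R.rad (RingHom.ker φ ⊓ I)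

/-- If `φ(c)ⁿ = 0`, then `cⁿ⁺¹` is the witness: the extra factor puts it in `I` even when `n = 0`.
-/
theorem nilRad_isGood : nilRad.{u}.IsGood where
  rad_rad I := Ideal.radical_idem I
  mem_rad_inf_ker _ φ I c hc hφ := by
    obtain ⟨n, hn⟩ := hφ
    refine ⟨n + 1, ?_, I.pow_mem_of_mem hc _ n.succ_pos⟩
    rw [SetLike.mem_coe, RingHom.mem_ker, map_pow, pow_succ, Ideal.mem_bot.1 hn, zero_mul]

/-- The counterpart of `cⁿ⁺¹` is `h(c) * c`, where `h` annihilates `φ c`. The factor `c` puts it in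
`I`, and `t ↦ h(t) * t` is still nonzero off the origin. -/
theorem inftyRad_isGood : inftyRad.{u}.IsGood where
  rad_rad I := inftyRadical_inftyRadical I
  mem_rad_inf_ker {B _ _ _} hC φ I c hc hφ := by
    obtain ⟨h, hh, h0⟩ := exists_op_eq_zero hC hφ
    refine mem_inftyRadical_of_op_mem (h * SmoothFn.proj 0)
      (fun t ht => mul_ne_zero (hh t ht) ht) ⟨?_, ?_⟩
    · rw [SetLike.mem_coe, RingHom.mem_ker, op_mul, map_mul, φ.map_op, h0, zero_mul]
    · rw [op_mul, CInftyRing.op_proj]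
      exact I.mul_mem_left _ hc

namespace Radical

variable {R : Radical.{u}}

theorem rad_mono {B : Type u} [CInftyRing B] {I J : Ideal B} (h : I ≤ J) : R.rad I ≤ R.rad J :=
  fun a ha => R.rad_le_comap (Hom.id B) (fun _ hb => h hb) a ha

/-- Equal reductions make the reduced tuple factor through the codiagonal, so the diagonal ideal
lands in the radical of zero and hence, by `mem_rad_inf_ker`, in the radical of its intersection
with the kernel. Idempotence of the radical then gives equality of radicals. The index `m + 1`
supplies the entry `x 0` through which to factor. -/
theorem IsGood.isNear_iff (hR : R.IsGood) {A B : Type u} [CInftyRing A] [CInftyRing B]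
    (hB : IsFinGen B) {m : ℕ} (x : Fin (m + 1) → (A →∞ B)) :
    R.IsNear x ↔ ∀ i j, (R.unit B).comp (x i) = (R.unit B).comp (x j) := by
  refine ⟨fun h => h.unit_comp_eq R, fun h => ?_⟩
  refine ⟨RingHom.ker (Copower.lift x) ⊓ Copower.diagIdeal A (m + 1),
    le_antisymm (rad_mono inf_le_right) ?_, fun c hc => hc.1⟩
  rw [← hR.rad_rad (_ ⊓ _)]
  refine rad_mono fun c hc => hR.mem_rad_inf_ker hB _ _ c hc ?_
  rw [← Ideal.Quotient.eq_zero_iff_mem]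
  change (R.unit B) (Copower.lift x c) = 0
  have h1 : (R.unit B).comp (Copower.lift x) =
      ((R.unit B).comp (x 0)).comp (Copower.lift fun _ : Fin (m + 1) => Hom.id A) :=
    Copower.hom_ext fun i a => DFunLike.congr_fun (h i 0) a
  have h2 := DFunLike.congr_fun h1 c
  rw [Hom.comp_apply, Hom.comp_apply, RingHom.mem_ker.1 hc, map_zero] at h2
  exact h2

theorem IsGood.isNear_pair_iff (hR : R.IsGood) {A B : Type u} [CInftyRing A] [CInftyRing B]
    (hB : IsFinGen B) (x y : A →∞ B) :
    R.IsNear ![x, y] ↔ (R.unit B).comp x = (R.unit B).comp y := by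
  rw [hR.isNear_iff hB]
  refine ⟨fun h => h 0 1, fun h i j => ?_⟩
  fin_cases i <;> fin_cases j <;> first | rfl | exact h | exact h.symm

theorem IsGood.formsGroupoid (hR : R.IsGood) (A : Type u) [CInftyRing A] : FormsGroupoid R A where
  refl Z x := (hR.isNear_pair_iff Z.finGen _ _).2 rfl
  symm Z x y h := (hR.isNear_pair_iff Z.finGen _ _).2 ((hR.isNear_pair_iff Z.finGen _ _).1 h).symm
  trans Z x y z h h' := (hR.isNear_pair_iff Z.finGen _ _).2
    (((hR.isNear_pair_iff Z.finGen _ _).1 h).trans ((hR.isNear_pair_iff Z.finGen _ _).1 h'))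
  isNear_iff Z k x := by
    simp only [hR.isNear_pair_iff Z.finGen, hR.isNear_iff Z.finGen]
    refine ⟨fun h i => h _ _, fun h => ?_⟩
    have h0 : ∀ i, (R.unit Z.ring).comp (x i) = (R.unit Z.ring).comp (x 0) := fun i => by
      induction i using Fin.induction with
      | zero => rfl
      | succ i ih => rw [← h i, ih]
    exact fun i j => (h0 i).trans (h0 j).symm

end Radical

end CInf

/-! ### Straight-line cones on topological simplices -/

namespace CInf
open CategoryTheory Opposite Simplicial

/-- The straight line from a point of a simplex to the cone point, in the cone over the simplex. -/
noncomputable def coneSegment (n : ℕ) :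
    C(stdSimplex ℝ (Fin (n + 1)) × unitInterval, stdSimplex ℝ (Fin (n + 2))) where
  toFun q := ⟨Fin.cons (q.2 : ℝ) fun i => (1 - q.2) * q.1 i, fun i => by
      cases i using Fin.cases with
      | zero => exact q.2.2.1
      | succ i => exact mul_nonneg (sub_nonneg.2 q.2.2.2) (stdSimplex.zero_le _ _), by
      rw [Fin.sum_univ_succ]
      simp [← Finset.mul_sum]⟩
  continuous_toFun := by
    refine Continuous.subtype_mk (continuous_pi fun i => ?_) _
    cases i using Fin.cases with
    | zero => exact continuous_subtype_val.comp continuous_snd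
    | succ i =>
      exact (continuous_const.sub (continuous_subtype_val.comp continuous_snd)).mul
        ((continuous_apply i).comp (continuous_subtype_val.comp continuous_fst))

theorem coneSegment_coe {n : ℕ} (z : stdSimplex ℝ (Fin (n + 1))) (s : unitInterval) :
    ⇑(coneSegment n (z, s)) = Fin.cons (s : ℝ) fun i => (1 - s) * z i := rfl

theorem coneSegment_zero {n : ℕ} (z : stdSimplex ℝ (Fin (n + 1))) :
    coneSegment n (z, 0) = stdSimplex.map Fin.succ z := by
  refine stdSimplex.ext (funext fun i => ?_)
  rw [coneSegment_coe, stdSimplex.map_coe, FunOnFinite.linearMap_apply_apply, Finset.sum_filter]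
  cases i using Fin.cases <;> simp

/-- Writing the cone point as the image of a 0-simplex under a constant map matches the simplicial
identity `Conical.vertex_cone`. -/
theorem coneSegment_one {n : ℕ} (z : stdSimplex ℝ (Fin (n + 1))) (w : stdSimplex ℝ (Fin 1)) :
    coneSegment n (z, 1) = stdSimplex.map (fun _ => 0) w := by
  refine stdSimplex.ext (funext fun i => ?_)
  rw [coneSegment_coe, stdSimplex.map_coe, FunOnFinite.linearMap_apply_apply, Finset.sum_filter]
  cases i using Fin.cases <;> simp [eq_comm]

/-- Affine maps preserve segments. This naturality is what lets the segments in the various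
simplices glue over a realization. -/
theorem coneSegment_map {m n : ℕ} (f : Fin (m + 1) → Fin (n + 1)) (z : stdSimplex ℝ (Fin (m + 1)))
    (s : unitInterval) : coneSegment n (stdSimplex.map f z, s) =
      stdSimplex.map (Fin.cons 0 fun i => (f i).succ : Fin (m + 2) → Fin (n + 2))
        (coneSegment m (z, s)) := by
  refine stdSimplex.ext (funext fun i => ?_)
  rw [coneSegment_coe, stdSimplex.map_coe, stdSimplex.map_coe, FunOnFinite.linearMap_apply_apply,
    Finset.sum_filter, Fin.sum_univ_succ, coneSegment_coe]
  cases i using Fin.cases with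
  | zero => simp
  | succ i =>
    rw [Fin.cons_succ, FunOnFinite.linearMap_apply_apply, Finset.sum_filter, Finset.mul_sum]
    simp [(Fin.succ_ne_zero _).symm]

/-! ### Geometric realization through its characteristic maps -/

section Realization

variable {X : SSet.{u}}

/-- The characteristic map of a simplex into the geometric realization. -/
noncomputable def simplexMap {n : SimplexCategory} (x : X.obj (op n)) :
    C(stdSimplex ℝ (Fin (n.len + 1)), SSet.toTop.obj X) :=
  TopCat.toSSetObjEquiv _ _ ((sSetTopAdj.unit.app X).app _ x)

theorem simplexMap_map {m n : SimplexCategory} (f : m ⟶ n) (x : X.obj (op n))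
    (z : stdSimplex ℝ (Fin (m.len + 1))) :
    simplexMap (X.map f.op x) z = simplexMap x (stdSimplex.map f z) := by
  have h := ConcreteCategory.congr_hom ((sSetTopAdj.unit.app X).naturality f.op) x
  exact DFunLike.congr_fun (congrArg (TopCat.toSSetObjEquiv _ _) h) z

/-- A continuous map out of the geometric realization from a compatible family of maps out of the
simplices. -/
noncomputable def realizationDesc {Y : TopCat.{u}}
    (g : ∀ n : SimplexCategory, X.obj (op n) → C(stdSimplex ℝ (Fin (n.len + 1)), Y))
    (hg : ∀ (m n : SimplexCategory) (f : m ⟶ n) (x : X.obj (op n))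
      (z : stdSimplex ℝ (Fin (m.len + 1))), g m (X.map f.op x) z = g n x (stdSimplex.map f z)) :
    SSet.toTop.obj X ⟶ Y :=
  (sSetTopAdj.homEquiv X Y).symm
    { app := fun n => ↾fun x => (TopCat.toSSetObjEquiv Y n).symm (g n.unop x)
      naturality := fun n m f => by
        refine ConcreteCategory.hom_ext _ _ fun x => ?_
        refine (TopCat.toSSetObjEquiv Y m).injective (ContinuousMap.ext fun z => ?_)
        exact hg _ _ f.unop x z }

theorem homEquiv_simplexMap {Y : TopCat.{u}} (f : SSet.toTop.obj X ⟶ Y) {n : SimplexCategory}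
    (x : X.obj (op n)) (z : stdSimplex ℝ (Fin (n.len + 1))) :
    f (simplexMap x z) =
      TopCat.toSSetObjEquiv Y _ ((sSetTopAdj.homEquiv X Y f).app (op n) x) z := by
  rw [Adjunction.homEquiv_unit]
  rfl

theorem realizationDesc_simplexMap {Y : TopCat.{u}}
    (g : ∀ n : SimplexCategory, X.obj (op n) → C(stdSimplex ℝ (Fin (n.len + 1)), Y)) (hg)
    {n : SimplexCategory} (x : X.obj (op n)) (z : stdSimplex ℝ (Fin (n.len + 1))) :
    realizationDesc g hg (simplexMap x z) = g n x z := by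
  rw [homEquiv_simplexMap, realizationDesc, Equiv.apply_symm_apply]
  rfl

theorem realization_hom_ext {Y : TopCat.{u}} {f g : SSet.toTop.obj X ⟶ Y}
    (h : ∀ (n : SimplexCategory) (x : X.obj (op n)) (z : stdSimplex ℝ (Fin (n.len + 1))),
      f (simplexMap x z) = g (simplexMap x z)) : f = g := by
  refine (sSetTopAdj.homEquiv X Y).injective ?_
  ext n x
  refine (TopCat.toSSetObjEquiv Y n).injective (ContinuousMap.ext fun z => ?_)
  have := h n.unop x z
  rwa [homEquiv_simplexMap, homEquiv_simplexMap] at this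

theorem realizationPt_eq (x : X _⦋0⦌) (z : stdSimplex ℝ (Fin 1)) :
    realizationPt x = simplexMap x z := by
  obtain rfl := Subsingleton.elim z default
  rfl

end Realization

/-! ### Contraction of a conical simplicial set -/

/-- The join of a map of simplices with the identity of a new initial vertex. -/
def coneHom {m n : SimplexCategory} (f : m ⟶ n) : ⦋m.len + 1⦌ ⟶ ⦋n.len + 1⦌ :=
  SimplexCategory.Hom.mk
    { toFun := Fin.cons 0 fun i => (f i).succ
      monotone' := fun i j hij => by
        cases i using Fin.cases with
        | zero => exact Fin.zero_le _
        | succ i =>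
          cases j using Fin.cases with
          | zero => exact absurd hij (by simp)
          | succ j =>
            exact Fin.succ_le_succ_iff.2 (f.toOrderHom.monotone (Fin.succ_le_succ_iff.1 hij)) }

/-- A natural way to cone off the simplices of `X`, with cone points indexed by a set `S` to which
`X` maps. -/
structure Conical (X : SSet.{u}) (S : Type u) where
  p : ∀ {n : SimplexCategory}, X.obj (op n) → S
  p_map : ∀ {m n : SimplexCategory} (f : m ⟶ n) (x : X.obj (op n)), p (X.map f.op x) = p x
  apex : S → X _⦋0⦌
  cone : ∀ {n : SimplexCategory}, X.obj (op n) → X _⦋n.len + 1⦌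
  map_cone : ∀ {m n : SimplexCategory} (f : m ⟶ n) (x : X.obj (op n)),
    X.map (coneHom f).op (cone x) = cone (X.map f.op x)
  face_cone : ∀ {n : SimplexCategory} (x : X.obj (op n)),
    X.map (SimplexCategory.δ (n := n.len) 0).op (cone x) = x
  vertex_cone : ∀ {n : SimplexCategory} (x : X.obj (op n)),
    X.map (SimplexCategory.const ⦋0⦌ ⦋n.len + 1⦌ 0).op (cone x) = apex (p x)

namespace Conical

variable {X : SSet.{u}} {S : Type u} (c : Conical X S)

/-- The contraction of the geometric realization to the cone points. -/
noncomputable def contraction :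
    SSet.toTop.obj X ⟶ TopCat.of C(unitInterval, SSet.toTop.obj X) :=
  -- The homotopy is curried into the path space because the universal property describes maps out
  -- of the realization, not out of its product with the interval.
  realizationDesc (fun n x => ((simplexMap (c.cone x)).comp (coneSegment n.len)).curry)
    fun m n f x z => ContinuousMap.ext fun s => by
      change simplexMap (c.cone _) (coneSegment _ (z, s)) =
        simplexMap (c.cone x) (coneSegment _ (_, s))
      rw [← c.map_cone, simplexMap_map, coneSegment_map]
      rfl

theorem contraction_simplexMap {n : SimplexCategory} (x : X.obj (op n))
    (z : stdSimplex ℝ (Fin (n.len + 1))) (s : unitInterval) :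
    (c.contraction (simplexMap x z) : C(unitInterval, SSet.toTop.obj X)) s =
      simplexMap (c.cone x) (coneSegment n.len (z, s)) := by
  rw [contraction, realizationDesc_simplexMap]
  rfl

theorem contraction_zero (w : SSet.toTop.obj X) :
    (c.contraction w : C(unitInterval, SSet.toTop.obj X)) 0 = w := by
  have : c.contraction ≫ TopCat.ofHom ⟨fun γ : C(unitInterval, SSet.toTop.obj X) => γ 0,
      continuous_eval_const (0 : unitInterval)⟩ = 𝟙 _ := realization_hom_ext fun n x z => by
    change (c.contraction (simplexMap x z) : C(unitInterval, SSet.toTop.obj X)) 0 = simplexMap x z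
    rw [contraction_simplexMap, coneSegment_zero]
    conv_rhs => rw [← c.face_cone x]
    exact (simplexMap_map (SimplexCategory.δ (n := n.len) 0) (c.cone x) z).symm
  exact ConcreteCategory.congr_hom this w

/-- At the end of the contraction, the connected components are points. -/
theorem contraction_one_eq {T : Type*} [TopologicalSpace T] [PreconnectedSpace T]
    (γ : C(T, SSet.toTop.obj X)) (t t' : T) :
    (c.contraction (γ t) : C(unitInterval, SSet.toTop.obj X)) 1 =
      (c.contraction (γ t') : C(unitInterval, SSet.toTop.obj X)) 1 := by
  -- With `S` discrete, `p` induces a continuous map `q` to `S`, and the end of the contraction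
  -- factors through it; a connected source then has constant image.
  let _ : TopologicalSpace S := ⊥
  have : DiscreteTopology S := ⟨rfl⟩
  let q : SSet.toTop.obj X ⟶ TopCat.of S :=
    realizationDesc (fun n x => ContinuousMap.const _ (c.p x)) fun m n f x z => c.p_map f x
  have : c.contraction ≫ TopCat.ofHom ⟨fun γ : C(unitInterval, SSet.toTop.obj X) => γ 1,
      continuous_eval_const (1 : unitInterval)⟩ =
        q ≫ TopCat.ofHom ⟨fun s : S => realizationPt (c.apex s), continuous_of_discreteTopology⟩ :=
    realization_hom_ext fun n x z => by
      change (c.contraction (simplexMap x z) : C(unitInterval, SSet.toTop.obj X)) 1 =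
        realizationPt (c.apex (q (simplexMap x z)))
      have hq : q (simplexMap x z) = c.p x := realizationDesc_simplexMap _ _ x z
      rw [hq, contraction_simplexMap, coneSegment_one z default, realizationPt_eq _ default,
        ← c.vertex_cone]
      exact (simplexMap_map (SimplexCategory.const ⦋0⦌ ⦋n.len + 1⦌ 0) (c.cone x) default).symm
  have h : ∀ t, (c.contraction (γ t) : C(unitInterval, SSet.toTop.obj X)) 1 =
      realizationPt (c.apex (q (γ t))) := fun t => ConcreteCategory.congr_hom this (γ t)
  rw [h, h, PreconnectedSpace.constant (f := fun t => (q (γ t) : S)) ‹_›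
    (q.hom.continuous.comp γ.continuous)]

/-- Homotopy groups vanish at the vertices over which the cone is degenerate. -/
theorem subsingleton_sPi {x : X _⦋0⦌}
    (hx : c.cone x = X.map (SimplexCategory.const ⦋1⦌ ⦋0⦌ 0).op x) (k : ℕ) :
    Subsingleton (sPi (k + 1) X x) := by
  -- The segment over the base point lies in a degenerate edge, so it stays at the base point; this
  -- makes the null homotopy relative to the boundary.
  have hpt : ∀ s, (c.contraction (realizationPt x) : C(unitInterval, SSet.toTop.obj X)) s =
      realizationPt x := fun s => by
    rw [realizationPt_eq x default, contraction_simplexMap, hx]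
    refine (simplexMap_map (SimplexCategory.const ⦋1⦌ ⦋0⦌ 0) x _).trans ?_
    congr 1
    exact Subsingleton.elim (α := stdSimplex ℝ (Fin 1)) _ _
  have key : ∀ a : sPi (k + 1) X x, a = Quotient.mk _ GenLoop.const := fun a => by
    induction a using Quotient.inductionOn with
    | h γ =>
      refine Quotient.sound ⟨⟨⟨⟨fun q => (c.contraction (γ.1 q.2) :
        C(unitInterval, SSet.toTop.obj X)) q.1, ?_⟩, fun t => ?_, fun t => ?_⟩, fun s t ht => ?_⟩⟩
      · exact ContinuousEval.continuous_eval.comp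
          ((c.contraction.hom.continuous.comp (γ.1.continuous.comp continuous_snd)).prodMk
            continuous_fst)
      · exact c.contraction_zero _
      · refine (c.contraction_one_eq γ.1 t fun _ => 0).trans ?_
        -- The origin is a boundary point of the cube because the dimension `k + 1` is positive. It
        -- identifies the constant end of the homotopy as the base point.
        have h0 : γ.1 (fun _ => 0) = realizationPt x := γ.2 _ ⟨0, Or.inl rfl⟩
        rw [h0, hpt]
        rfl
      · change (c.contraction (γ.1 t) : C(unitInterval, SSet.toTop.obj X)) s = γ.1 t
        rw [γ.2 t ht, hpt]
  exact ⟨fun a b => (key a).trans (key b).symm⟩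

end Conical

end CInf

/-! ### The de Rham nerve and its weak equivalences -/

namespace CInf
open CategoryTheory Opposite Simplicial

/-- Constant simplicial sets are conical. -/
def constConical (S : Type u) : Conical ((SimplicialObject.const (Type u)).obj S) S where
  p x := x
  p_map _ _ := rfl
  apex s := s
  cone x := x
  map_cone _ _ := rfl
  face_cone _ := rfl
  vertex_cone _ := rfl

section Nerve

variable {R : Radical.{u}} (hR : R.IsGood) {A : Type u} [CInftyRing A] (Z : FGScheme.{u}ᵒᵖ)

/-- A section of the reduction map on points exhibits the sections of the nerve of the de Rham
groupoid as conical. -/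
noncomputable def nerveConical (σ : (A →∞ R.Red Z.unop.ring) → (A →∞ Z.unop.ring))
    (hσ : ∀ s, (R.unit _).comp (σ s) = s) :
    Conical ((deRhamNerve R A (hR.formsGroupoid A)).obj Z) (A →∞ R.Red Z.unop.ring) where
  p x := (R.unit _).comp (x.1 0)
  p_map _ x := x.2.unit_comp_eq R _ _
  apex s := ⟨fun _ => σ s, (hR.isNear_iff Z.unop.finGen _).2 fun _ _ => rfl⟩
  cone {n} x := ⟨(Fin.cons (σ ((R.unit _).comp (x.1 0))) x.1 : Fin (n.len + 2) → _), by
    have h0 : ∀ i, (R.unit _).comp ((Fin.cons (σ ((R.unit _).comp (x.1 0))) x.1 :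
        Fin (n.len + 2) → (A →∞ Z.unop.ring)) i) = (R.unit _).comp (x.1 0) := fun i => by
      cases i using Fin.cases with
      | zero => exact hσ _
      | succ i => exact x.2.unit_comp_eq R _ _
    exact (hR.isNear_iff Z.unop.finGen _).2 fun i j => (h0 i).trans (h0 j).symm⟩
  map_cone {m n} f x := Subtype.ext (funext fun i => by
    cases i using Fin.cases with
    | zero => exact congrArg σ (x.2.unit_comp_eq R _ _)
    | succ i => rfl)
  face_cone _ := rfl
  vertex_cone _ := rfl

/-- On components, points with equal reductions are joined by an edge, and injectivity gives
surjectivity. All higher homotopy groups on both sides are trivial. The section `σ` is chosen for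
one `Z` at a time and need not be natural in `Z`. -/
theorem isWeakEquivalence_nerveToDeRham (hA : R.IsInjective A) :
    IsWeakEquivalence ((nerveToDeRham R A (hR.formsGroupoid A)).app Z) := by
  refine ⟨⟨fun a b hab => ?_, fun b => ?_⟩, fun n x => ?_⟩
  · induction a with | mk x
    induction b with | mk y
    rw [SSet.mapπ₀_mk, SSet.mapπ₀_mk] at hab
    have h1 : (R.unit _).comp (x.1 0) = (R.unit _).comp (y.1 0) := by
      -- Edges of a constant simplicial set have equal ends, so its components recover the elements
      -- of the set.
      have h2 := congrArg (SSet.π₀.lift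
        (X := (SimplicialObject.const (Type u)).obj (A →∞ R.Red Z.unop.ring)) (fun s => s)
        fun s t e => e.src_eq.symm.trans e.tgt_eq) hab
      exact h2
    refine SSet.π₀.sound (SSet.Edge.mk ⟨![x.1 0, y.1 0],
      (hR.isNear_pair_iff Z.unop.finGen _ _).2 h1⟩ ?_ ?_) <;>
    exact Subtype.ext (funext fun i => by obtain rfl : i = 0 := Subsingleton.elim (α := Fin 1) i 0; rfl)
  · induction b with | mk s
    obtain ⟨x, hx⟩ := hA _ s
    exact ⟨SSet.π₀.mk ⟨fun _ => x, (hR.isNear_iff Z.unop.finGen _).2 fun _ _ => rfl⟩,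
      congrArg SSet.π₀.mk hx⟩
  · classical
    choose σ hσ using hA Z.unop.ring
    -- Modifying the section to send the reduction of `x` to `x` itself makes the cone over this
    -- vertex degenerate, as `subsingleton_sPi` requires.
    have h1 := (nerveConical hR Z (Function.update σ ((R.unit _).comp (x.1 0)) (x.1 0)) fun s => by
      rcases eq_or_ne s ((R.unit _).comp (x.1 0)) with rfl | hs
      · rw [Function.update_self]
      · rw [Function.update_of_ne hs, hσ]).subsingleton_sPi (x := x) (Subtype.ext (funext fun i => by
        cases i using Fin.cases with
        | zero => exact Function.update_self ((R.unit _).comp (x.1 0)) (x.1 0) σ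
        | succ i => exact congrArg x.1 (Subsingleton.elim (α := Fin 1) _ _))) n
    have h2 := (constConical (A →∞ R.Red Z.unop.ring)).subsingleton_sPi
      (x := ((nerveToDeRham R A (hR.formsGroupoid A)).app Z).app _ x) rfl n
    exact ⟨fun _ _ _ => h1.elim _ _, fun b => ⟨Quotient.mk _ GenLoop.const, h2.elim _ _⟩⟩

end Nerve

theorem W_of_bijective {C : Type*} [Category* C] (J : GrothendieckTopology C)
    {P Q : Cᵒᵖ ⥤ Type u} (f : P ⟶ Q) (h : ∀ Z, Function.Bijective (f.app Z)) : J.W f := by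
  have : ∀ Z, IsIso (f.app Z) := fun Z => (isIso_iff_bijective _).2 (h Z)
  have : IsIso f := NatIso.isIso_of_isIso_app f
  exact MorphismProperty.of_isIso _ f

/-- Global weak equivalences are local weak equivalences. -/
theorem IsGlobalWeakEquivalence.isLocalWeakEquivalence {C : Type*} [Category* C]
    (J : GrothendieckTopology C) {F G : Cᵒᵖ ⥤ SSet.{u}} {f : F ⟶ G}
    (hf : IsGlobalWeakEquivalence f) : IsLocalWeakEquivalence J f := by
  refine ⟨W_of_bijective _ _ fun Z => (hf Z).1, fun n Z x => W_of_bijective _ _ fun V => ?_⟩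
  have h := (hf (op V.unop.left)).2 n ((F.map V.unop.hom.op).app _ x)
  -- The base point in the target presheaf is the restriction of the image of `x`, equal to the
  -- image of the restriction only by naturality; generalizing it allows the substitution.
  have key : ∀ (y) (e : (f.app (op V.unop.left)).app _ ((F.map V.unop.hom.op).app _ x) = y),
      Function.Bijective (sPiMap (n + 1) (f.app (op V.unop.left)) e) := by
    rintro _ rfl
    exact h
  exact key _ (app_restrict_vertex f x V.unop)

theorem Radical.IsGood.exists_isWeakEquivalence {R : Radical.{u}} (hR : R.IsGood) (A : Type u) [CInftyRing A]
    (hA : R.IsInjective A) : ∃ h : FormsGroupoid R A,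
      IsGlobalWeakEquivalence (nerveToDeRham R A h) ∧
        IsLocalWeakEquivalence zariski (nerveToDeRham R A h) :=
  have h : IsGlobalWeakEquivalence (nerveToDeRham R A (hR.formsGroupoid A)) := fun Z =>
    isWeakEquivalence_nerveToDeRham hR Z hA
  ⟨hR.formsGroupoid A, h, h.isLocalWeakEquivalence zariski⟩

end CInf

theorem mainTheorem6 (A : Type u) [CInf.CInftyRing A] :
    (CInf.nilRad.IsInjective A →
      ∃ h : CInf.FormsGroupoid CInf.nilRad A,
        CInf.IsGlobalWeakEquivalence (CInf.nerveToDeRham CInf.nilRad A h) ∧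
        CInf.IsLocalWeakEquivalence CInf.zariski (CInf.nerveToDeRham CInf.nilRad A h)) ∧
    (CInf.inftyRad.IsInjective A →
      ∃ h : CInf.FormsGroupoid CInf.inftyRad A,
        CInf.IsGlobalWeakEquivalence (CInf.nerveToDeRham CInf.inftyRad A h) ∧
        CInf.IsLocalWeakEquivalence CInf.zariski (CInf.nerveToDeRham CInf.inftyRad A h)) :=
  ⟨CInf.nilRad_isGood.exists_isWeakEquivalence A, CInf.inftyRad_isGood.exists_isWeakEquivalence A⟩
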